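/- **Proposition 1.7 (Chern–Lu type identity).** Let $(M,h)$ be a Hermitian manifold of complex dimension $m$, let $(N,g)$ be a Riemannian manifold of dimension $n$ with Levi-Civita connection coefficients $\Gamma^i_{jk}$, and let $f:M\to N$ be a smooth map. For local holomorphic coordinates $z^\alpha$ on $M$ and local coordinates $y^i$ on $N$ write $f^i_\alpha=\partial f^i/\partial z^\alpha$, $f^i_{\bar\beta}=\partial f^i/\partial\bar z^\beta$, $e_i=f^*(\partial/\partial y^i)$, $h_{\alpha\bar\beta}=h(\partial_\alpha,\bar\partial_\beta)$, and define $h^{\gamma\bar\delta}$ by $\sum_\delta h^{\gamma\bar\delta}h_{\mu\bar\delta}=\delta^\gamma_\mu$. Assume that $f$ is pluri-harmonic, i.e. $\partial_{\mathscr E}\bar\partial f=0$ for $\mathscr E=f^*TN$; in all such coordinates $$\frac{\partial^2 f^i}{\partial z^\alpha\partial\bar z^\beta}+\Gamma^i_{jk}(f)\,f^j_{\bar\beta}f^k_\alpha=0\qquad\text{for all }i,\alpha,\beta .$$ Let $\mathscr F=T^{*1,0}M\otimes f^*TN$ (with $TN$ complexified), with the metric induced by $h$ and $g$, and let $\partial_{\mathscr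 F}$ be the $(1,0)$-part of the connection induced by the Chern connection of $(T^{1,0}M,h)$ and the Levi-Civita connection of $(N,g)$. Let $u=|\partial f|^2=h^{\gamma\bar\delta}g_{ij}f^i_\gamma f^j_{\bar\delta}$. Let $R^M_{\alpha\bar\beta\gamma\bar\delta}=-\dfrac{\partial^2h_{\gamma\bar\delta}}{\partial z^\alpha\partial\bar z^\beta}+h^{\mu\bar\nu}\dfrac{\partial h_{\gamma\bar\nu}}{\partial z^\alpha}\dfrac{\partial h_{\mu\bar\delta}}{\partial\bar z^\beta}$ be the curvature of the Chern connection on $T^{1,0}M$, and let $R^N_{ijk\ell}=g(R(\partial_i,\partial_j)\partial_k,\partial_\ell)$ with $R(X,Y)Z=\nabla_X\nabla_YZ-\nabla_Y\nabla_XZ-\nabla_{[X,Y]}Z$. Then $u$ is a well-defined smooth function on $M$, and in all such coordinates $$\partial\bar\partial u=\langle\partial_{\mathscr F}\partial f,\partial_{\mathscr F}\partial f\rangle+\Big(R^M_{\alpha\bar\beta\gamma\bar\delta}\,h^{\gamma\bar\nu}h^{\mu\bar\delta}g_{ij}f^i_\mu f^j_{\bar\nu}-R^N_{i\ell kj}\,f^i_\alpha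 f^j_{\bar\beta}\big(h^{\gamma\bar\delta}f^k_\gamma f^\ell_{\bar\delta}\big)\Big)\,dz^\alpha\wedge d\bar z^\beta .$$ Here, if $\partial_{\mathscr F}\partial f=D_\alpha f^i_\gamma\,dz^\alpha\otimes(dz^\gamma\otimes e_i)$, then $\langle\partial_{\mathscr F}\partial f,\partial_{\mathscr F}\partial f\rangle=h^{\gamma\bar\delta}g_{ij}\,D_\alpha f^i_\gamma\,\overline{D_\beta f^j_\delta}\;dz^\alpha\wedge d\bar z^\beta$. Moreover, with $\Delta_hu=h^{\alpha\bar\beta}\dfrac{\partial^2u}{\partial z^\alpha\partial\bar z^\beta}$ and $|\partial_{\mathscr F}\partial f|^2=h^{\alpha\bar\beta}h^{\gamma\bar\delta}g_{ij}\,D_\alpha f^i_\gamma\,\overline{D_\beta f^j_\delta}$, $$\Delta_hu=|\partial_{\mathscr F}\partial f|^2+\big(h^{\alpha\bar\beta}R^M_{\alpha\bar\beta\gamma\bar\delta}\big)h^{\gamma\bar\nu}h^{\mu\bar\delta}g_{ij}f^i_\mu f^j_{\bar\nu}-R^N_{i\ell kj}\big(h^{\alpha\bar\beta}f^i_\alpha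 f^j_{\bar\beta}\big)\big(h^{\gamma\bar\delta}f^k_\gamma f^\ell_{\bar\delta}\big).$$ -/

import Mathlib

open scoped Manifold ContDiff ComplexConjugate

noncomputable section

namespace ChernLu

/-- The model space `ℂᵐ`. -/
abbrev CE (m : ℕ) := EuclideanSpace ℂ (Fin m)

/-- The model space `ℝⁿ`. -/
abbrev RE (n : ℕ) := EuclideanSpace ℝ (Fin n)

variable {m n : ℕ}

/-! ### Partial derivatives in coordinates -/

/-- `∂/∂z^α = (∂/∂x^α - i ∂/∂y^α) / 2`, where `z^α = x^α + i y^α`. -/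
def delz (α : Fin m) (φ : CE m → ℂ) (z : CE m) : ℂ :=
  (fderiv ℝ φ z (EuclideanSpace.single α 1)
    - Complex.I * fderiv ℝ φ z (EuclideanSpace.single α Complex.I)) / 2

/-- `∂/∂z̄^α = (∂/∂x^α + i ∂/∂y^α) / 2`. -/
def delzbar (α : Fin m) (φ : CE m → ℂ) (z : CE m) : ℂ :=
  (fderiv ℝ φ z (EuclideanSpace.single α 1)
    + Complex.I * fderiv ℝ φ z (EuclideanSpace.single α Complex.I)) / 2

/-- `∂/∂y^i` on functions of the real coordinates `y¹, …, yⁿ`. -/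
def dely (i : Fin n) (φ : RE n → ℝ) (y : RE n) : ℝ :=
  fderiv ℝ φ y (EuclideanSpace.single i 1)

/-! ### Riemannian geometry in coordinates

`G y` is the matrix `(g_ij)` of a Riemannian metric in the coordinates `y`. -/

/-- Christoffel symbols `Γ^k_{ij}` of the Levi-Civita connection. -/
def christoffel (G : RE n → Matrix (Fin n) (Fin n) ℝ) (k i j : Fin n) (y : RE n) : ℝ :=
  (1 / 2) * ∑ l, (G y)⁻¹ k l *
    (dely i (fun x => G x j l) y + dely j (fun x => G x i l) y - dely l (fun x => G x i j) y)

/-- `R_{ijk}^l`, where `R(∂_i, ∂_j) ∂_k = R_{ijk}^l ∂_l` and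
`R(X,Y)Z = ∇_X ∇_Y Z - ∇_Y ∇_X Z - ∇_{[X,Y]} Z`. -/
def riemannUp (G : RE n → Matrix (Fin n) (Fin n) ℝ) (i j k l : Fin n) (y : RE n) : ℝ :=
  dely i (christoffel G l k j) y - dely j (christoffel G l k i) y
    + ∑ p, (christoffel G p k j y * christoffel G l p i y
        - christoffel G p k i y * christoffel G l p j y)

/-- `R_{ijkl} = g(R(∂_i, ∂_j) ∂_k, ∂_l)`. -/
def riemann (G : RE n → Matrix (Fin n) (Fin n) ℝ) (i j k l : Fin n) (y : RE n) : ℝ :=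
  ∑ s, G y s l * riemannUp G i j k s y

/-! ### Hermitian geometry in coordinates

`H z` is the matrix `(h_{αβ̄})` of a Hermitian metric in the holomorphic coordinates `z`. -/

/-- `h^{γδ̄}`, normalised by `∑_δ h^{γδ̄} h_{μδ̄} = δ^γ_μ`. -/
def hInv (H : CE m → Matrix (Fin m) (Fin m) ℂ) (γ δ : Fin m) (z : CE m) : ℂ :=
  (H z)⁻¹ δ γ

/-- Coefficients of the Chern connection on `T^{1,0}M`:
`∇ ∂_γ = Γ^μ_{αγ} dz^α ⊗ ∂_μ` with `Γ^μ_{αγ} = h^{μν̄} ∂_α h_{γν̄}`. -/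
def chernConn (H : CE m → Matrix (Fin m) (Fin m) ℂ) (μ α γ : Fin m) (z : CE m) : ℂ :=
  ∑ ν, hInv H μ ν z * delz α (fun w => H w γ ν) z

/-- The curvature `R_{αβ̄γδ̄} = h_{μδ̄} R_{αβ̄γ}^μ` of the Chern connection, where
`R(∂_α, ∂̄_β) ∂_γ = R_{αβ̄γ}^μ ∂_μ`, `R_{αβ̄γ}^μ = - ∂Γ^μ_{αγ}/∂z̄^β`. Equivalently
`R_{αβ̄γδ̄} = - ∂²h_{γδ̄}/∂z^α∂z̄^β + h^{μν̄} (∂h_{γν̄}/∂z^α) (∂h_{μδ̄}/∂z̄^β)`. -/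
def chernCurv (H : CE m → Matrix (Fin m) (Fin m) ℂ) (α β γ δ : Fin m) (z : CE m) : ℂ :=
  ∑ μ, H z μ δ * (- delzbar β (chernConn H μ α γ) z)

/-! ### Maps in coordinates

`F : ℂᵐ → ℝⁿ` is the coordinate expression of a map `f : M → N`. Sections of (the complexification
of) `𝓔 = f^* TN` are given by components `s^i`, those of `𝓕 = T^{*1,0}M ⊗ f^* TN` by components
`s^i_γ`. -/

/-- `f^i_α = ∂f^i/∂z^α`. -/
def delF (F : CE m → RE n) (i : Fin n) (α : Fin m) : CE m → ℂ :=
  delz α (fun w => ((F w i : ℝ) : ℂ))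

/-- `f^i_ᾱ = ∂f^i/∂z̄^α`. -/
def delbarF (F : CE m → RE n) (i : Fin n) (α : Fin m) : CE m → ℂ :=
  delzbar α (fun w => ((F w i : ℝ) : ℂ))

/-- The `(1,0)` part of the pull-back connection on `𝓔 = f^* TN`: the coefficient of
`dz^α ⊗ e_i` in `∂_𝓔 (s^i e_i)`. -/
def nablaE (G : RE n → Matrix (Fin n) (Fin n) ℝ) (F : CE m → RE n)
    (s : Fin n → CE m → ℂ) (α : Fin m) (i : Fin n) (z : CE m) : ℂ :=
  delz α (s i) z + ∑ j, ∑ k, (christoffel G i j k (F z) : ℂ) * delF F j α z * s k z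

/-- The `(1,0)` part of the connection on `𝓕 = T^{*1,0}M ⊗ f^* TN` induced by the Chern connection
and the pull-back of the Levi-Civita connection: the coefficient of `dz^α ⊗ (dz^γ ⊗ e_i)` in
`∂_𝓕 (s^i_γ dz^γ ⊗ e_i)`. -/
def nablaF (H : CE m → Matrix (Fin m) (Fin m) ℂ) (G : RE n → Matrix (Fin n) (Fin n) ℝ)
    (F : CE m → RE n) (s : Fin n → Fin m → CE m → ℂ) (α : Fin m) (i : Fin n) (γ : Fin m)
    (z : CE m) : ℂ :=
  nablaE G F (fun k => s k γ) α i z - ∑ δ, chernConn H δ α γ z * s i δ z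

/-- The coefficients of `∂_𝓕 ∂f`. -/
def nablaDelF (H : CE m → Matrix (Fin m) (Fin m) ℂ) (G : RE n → Matrix (Fin n) (Fin n) ℝ)
    (F : CE m → RE n) (α : Fin m) : Fin n → Fin m → CE m → ℂ :=
  nablaF H G F (delF F) α

/-- The Hermitian metric of `𝓕` at the point with coordinates `z`:
`⟨s, t⟩ = h^{γδ̄} g_ij s^i_γ conj (t^j_δ)`. -/
def innerF (H : CE m → Matrix (Fin m) (Fin m) ℂ) (G : RE n → Matrix (Fin n) (Fin n) ℝ)
    (F : CE m → RE n) (s t : Fin n → Fin m → CE m → ℂ) (z : CE m) : ℂ :=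
  ∑ γ, ∑ δ, ∑ i, ∑ j, hInv H γ δ z * (G (F z) i j : ℂ) * s i γ z * conj (t j δ z)

/-- The coefficient of `dz^α ∧ dz̄^β` in `⟨∂_𝓕 ∂f, ∂_𝓕 ∂f⟩`; for `𝓕`-valued forms one has
`⟨φ ⊗ s, ψ ⊗ t⟩ = ⟨s, t⟩ φ ∧ conj ψ`. -/
def gradTerm (H : CE m → Matrix (Fin m) (Fin m) ℂ) (G : RE n → Matrix (Fin n) (Fin n) ℝ)
    (F : CE m → RE n) (α β : Fin m) (z : CE m) : ℂ :=
  innerF H G F (nablaDelF H G F α) (nablaDelF H G F β) z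

/-- `R^M_{αβ̄γδ̄} h^{γν̄} h^{μδ̄} g_ij f^i_μ f^j_ν̄`. -/
def domainCurvTerm (H : CE m → Matrix (Fin m) (Fin m) ℂ) (G : RE n → Matrix (Fin n) (Fin n) ℝ)
    (F : CE m → RE n) (α β : Fin m) (z : CE m) : ℂ :=
  ∑ γ, ∑ δ, ∑ μ, ∑ ν, ∑ i, ∑ j, chernCurv H α β γ δ z * hInv H γ ν z * hInv H μ δ z *
    (G (F z) i j : ℂ) * delF F i μ z * delbarF F j ν z

/-- `R^N_{iℓkj} f^i_α f^j_β̄ (h^{γδ̄} f^k_γ f^ℓ_δ̄)`. -/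
def targetCurvTerm (H : CE m → Matrix (Fin m) (Fin m) ℂ) (G : RE n → Matrix (Fin n) (Fin n) ℝ)
    (F : CE m → RE n) (α β : Fin m) (z : CE m) : ℂ :=
  ∑ i, ∑ l, ∑ k, ∑ j, (riemann G i l k j (F z) : ℂ) * delF F i α z * delbarF F j β z *
    ∑ γ, ∑ δ, hInv H γ δ z * delF F k γ z * delbarF F l δ z

/-! ### Manifolds -/

section Manifold

variable {M : Type*} [TopologicalSpace M] [ChartedSpace (CE m) M]
  {N : Type*} [TopologicalSpace N] [ChartedSpace (RE n) N]

/-- The holomorphic coordinate vector `∂/∂z^α` at the point with coordinates `z`. The complex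
tangent space `T_p M` (with its complex structure `J`) is identified with `T^{1,0}_p M`
by `v ↦ (v - i J v) / 2`. -/
def coordVecM (e : OpenPartialHomeomorph M (CE m)) (α : Fin m) (z : CE m) :
    TangentSpace 𝓘(ℂ, CE m) (e.symm z) :=
  mfderiv 𝓘(ℂ, CE m) 𝓘(ℂ, CE m) e.symm z (EuclideanSpace.single α (1 : ℂ) : CE m)

/-- The coordinate vector `∂/∂y^i` at the point with coordinates `y`. -/
def coordVecN (ψ : OpenPartialHomeomorph N (RE n)) (i : Fin n) (y : RE n) :
    TangentSpace (𝓡 n) (ψ.symm y) :=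
  mfderiv (𝓡 n) (𝓡 n) ψ.symm y (EuclideanSpace.single i (1 : ℝ) : RE n)

variable (m M) in
/-- A smooth Hermitian metric on the holomorphic tangent bundle `T^{1,0}M`, as a family of positive
definite Hermitian forms `h(v, w)`, linear in `v` and conjugate-linear in `w`, whose
components in every holomorphic chart are smooth functions (in the real sense). -/
structure HermitianMetric [IsManifold 𝓘(ℂ, CE m) ω M] where
  form (p : M) : TangentSpace 𝓘(ℂ, CE m) p →ₗ[ℂ] TangentSpace 𝓘(ℂ, CE m) p →ₗ⋆[ℂ] ℂ
  symm (p : M) (v w : TangentSpace 𝓘(ℂ, CE m) p) : conj (form p v w) = form p w v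
  pos (p : M) (v : TangentSpace 𝓘(ℂ, CE m) p) : v ≠ 0 → 0 < (form p v v).re
  smooth (e : OpenPartialHomeomorph M (CE m))
    (he : e ∈ IsManifold.maximalAtlas 𝓘(ℂ, CE m) ω M) (α β : Fin m) :
    ContDiffOn ℝ ∞ (fun z => form (e.symm z) (coordVecM e α z) (coordVecM e β z)) e.target

/-- `h_{αβ̄} = h(∂/∂z^α, ∂/∂z^β)` in the chart `e`. -/
def HermitianMetric.matrix [IsManifold 𝓘(ℂ, CE m) ω M] (h : HermitianMetric m M)
    (e : OpenPartialHomeomorph M (CE m)) (z : CE m) : Matrix (Fin m) (Fin m) ℂ :=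
  Matrix.of fun α β => h.form (e.symm z) (coordVecM e α z) (coordVecM e β z)

variable (n N) in
/-- Smooth Riemannian metrics on `N`. -/
abbrev RiemMetric [IsManifold (𝓡 n) ∞ N] :=
  Bundle.ContMDiffRiemannianMetric (𝓡 n) ∞ (RE n) (fun q : N => TangentSpace (𝓡 n) q)

/-- `g_ij = g(∂/∂y^i, ∂/∂y^j)` in the chart `ψ`. -/
def metricMatrix [IsManifold (𝓡 n) ∞ N] (g : RiemMetric n N)
    (ψ : OpenPartialHomeomorph N (RE n)) (y : RE n) : Matrix (Fin n) (Fin n) ℝ :=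
  Matrix.of fun i j => g.inner (ψ.symm y) (coordVecN ψ i y) (coordVecN ψ j y)

/-- The coordinate expression of `f` in the charts `e` and `ψ`. -/
def localRep (e : OpenPartialHomeomorph M (CE m)) (ψ : OpenPartialHomeomorph N (RE n))
    (f : M → N) (z : CE m) : RE n :=
  ψ (f (e.symm z))

/-- `f` is pluri-harmonic, i.e. `∂_𝓔 ∂̄f = 0`: in all local coordinates
`∂²f^i/∂z^α∂z̄^β + Γ^i_{jk}(f) f^j_α f^k_β̄ = 0`, the coefficient of `dz^α ∧ dz̄^β ⊗ e_i` in
`∂_𝓔 (f^i_β̄ dz̄^β ⊗ e_i)`. -/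
def IsPluriharmonic [IsManifold 𝓘(ℂ, CE m) ω M] [IsManifold (𝓡 n) ∞ N]
    (g : RiemMetric n N) (f : M → N) : Prop :=
  ∀ e ∈ IsManifold.maximalAtlas 𝓘(ℂ, CE m) ω M, ∀ ψ ∈ IsManifold.maximalAtlas (𝓡 n) ∞ N,
    ∀ p ∈ e.source, f p ∈ ψ.source → ∀ (α β : Fin m) (i : Fin n),
      nablaE (metricMatrix g ψ) (localRep e ψ f)
        (fun k => delbarF (localRep e ψ f) k β) α i (e p) = 0

/-- The real differential of `f` at `p`. -/
def realDiff (f : M → N) (p : M) (v : TangentSpace 𝓘(ℂ, CE m) p) : TangentSpace (𝓡 n) (f p) :=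
  mfderiv 𝓘(ℝ, CE m) (𝓡 n) f p (v : TangentSpace 𝓘(ℝ, CE m) p)

/-- The value `⟨a + i b, c + i d⟩ = g(a, c) + g(b, d) + i (g(b, c) - g(a, d))` on `T_q N ⊗ ℂ`
of the Hermitian (linear in the first slot) extension of `g`. -/
def gHerm [IsManifold (𝓡 n) ∞ N] (g : RiemMetric n N) (q : N)
    (a b c d : TangentSpace (𝓡 n) q) : ℂ :=
  ((g.inner q a c + g.inner q b d : ℝ) : ℂ)
    + Complex.I * ((g.inner q b c - g.inner q a d : ℝ) : ℂ)

/-- `⟨∂f(v), ∂f(w)⟩`, where `∂f(v) = df((v - i J v) / 2) = df(v) / 2 + i (- df(J v) / 2)`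
in `T_{f(p)} N ⊗ ℂ`. -/
def delPairing [IsManifold (𝓡 n) ∞ N] (g : RiemMetric n N) (f : M → N) (p : M)
    (v w : TangentSpace 𝓘(ℂ, CE m) p) : ℂ :=
  gHerm g (f p)
    ((1 / 2 : ℝ) • realDiff f p v) (-((1 / 2 : ℝ) • realDiff f p (Complex.I • v)))
    ((1 / 2 : ℝ) • realDiff f p w) (-((1 / 2 : ℝ) • realDiff f p (Complex.I • w)))

/-- The trace `h^{γδ̄} Q(b_γ, b_δ)` of a sesquilinear form `Q` with respect to a Hermitian form
`h`; it does not depend on the basis `b`. -/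
def hermTrace {V : Type*} [AddCommGroup V] [Module ℂ V] (b : Module.Basis (Fin m) ℂ V)
    (h : V →ₗ[ℂ] V →ₗ⋆[ℂ] ℂ) (Q : V → V → ℂ) : ℂ :=
  ∑ γ, ∑ δ, (Matrix.of fun α β => h (b α) (b β))⁻¹ δ γ * Q (b γ) (b δ)

/-- The function `u = |∂f|²` on `M`: the trace with respect to `h` of
`(v, w) ↦ ⟨∂f(v), ∂f(w)⟩`, a real number since both forms are Hermitian. -/
def energy [IsManifold 𝓘(ℂ, CE m) ω M] [IsManifold (𝓡 n) ∞ N] (h : HermitianMetric m M)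
    (g : RiemMetric n N) (f : M → N) (p : M) : ℝ :=
  (hermTrace (V := TangentSpace 𝓘(ℂ, CE m) p)
    (EuclideanSpace.basisFun (Fin m) ℂ).toBasis (h.form p) (delPairing g f p)).re

/-- The value of `dz^α` at `v ∈ T_p M`. -/
def dz (e : OpenPartialHomeomorph M (CE m)) (p : M) (α : Fin m)
    (v : TangentSpace 𝓘(ℂ, CE m) p) : ℂ :=
  let ζ : CE m := mfderiv 𝓘(ℂ, CE m) 𝓘(ℂ, CE m) e p v
  ζ α

/-- The `(1,1)`-form `∑ A_{αβ} dz^α ∧ dz̄^β` at `p`, evaluated at `v, w ∈ T_p M`. -/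
def form11 (e : OpenPartialHomeomorph M (CE m)) (p : M) (A : Fin m → Fin m → ℂ)
    (v w : TangentSpace 𝓘(ℂ, CE m) p) : ℂ :=
  ∑ α, ∑ β, A α β * (dz e p α v * conj (dz e p β w) - dz e p α w * conj (dz e p β v))

/-- `∂²u/∂z^α∂z̄^β` in the chart `e`. -/
def complexHessian (e : OpenPartialHomeomorph M (CE m)) (u : M → ℝ) (α β : Fin m) : CE m → ℂ :=
  delz α (delzbar β (fun w => ((u (e.symm w) : ℝ) : ℂ)))

/-- The `(1,1)`-form `∂∂̄u = (∂²u/∂z^α∂z̄^β) dz^α ∧ dz̄^β` at `p`, in the chart `e`. -/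
def ddbar (e : OpenPartialHomeomorph M (CE m)) (u : M → ℝ) (p : M)
    (v w : TangentSpace 𝓘(ℂ, CE m) p) : ℂ :=
  form11 e p (fun α β => complexHessian e u α β (e p)) v w

/-- The trace `h^{αβ̄} A_{αβ̄}` of a `(1,1)`-form, in coordinates. -/
def tr11 (H : CE m → Matrix (Fin m) (Fin m) ℂ) (A : Fin m → Fin m → CE m → ℂ) (z : CE m) : ℂ :=
  ∑ α, ∑ β, hInv H α β z * A α β z

/-- `Δ_h u = h^{αβ̄} ∂²u/∂z^α∂z̄^β` at `p`, in the chart `e`. -/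
def laplacian [IsManifold 𝓘(ℂ, CE m) ω M] (h : HermitianMetric m M)
    (e : OpenPartialHomeomorph M (CE m)) (u : M → ℝ) (p : M) : ℂ :=
  tr11 (h.matrix e) (complexHessian e u) (e p)

end Manifold

end ChernLu

end

/-! Idea of the proof. In charts, `u` is the trace `h^{γδ̄} ⟨∂_γ f, ∂̄_δ f⟩`, with the metric of `N`
extended bilinearly. The Levi-Civita pull-back connection preserves this pairing (`cderiv_pairing`),
and the Chern connection absorbs the derivatives of `h^{γδ̄}`; so `u` obeys a Leibniz rule with
covariant derivatives (`delz_traceForm`, `delzbar_traceForm`).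

Pluriharmonicity says `∇_α ∂̄_β f = 0`, and its conjugate says `∇_β̄ ∂_α f = 0`. Hence `∂_α u` is
the trace of `⟨∇_α ∂_γ f, ∂̄_δ f⟩` alone. Applying `∂̄_β` yields two terms. If the derivative falls
on `∂̄_δ f`, the result is the gradient term. If it falls on `∇_α ∂_γ f`, then, because `∇_β̄ ∂f =
0`, only a commutator survives: the pulled-back curvature of `N` (`pullbackConn_commutator`) and the
`∂̄`-derivative of the Chern coefficients, which is the curvature of `M`.

The target term comes out as `-R^N(∂_α f, ∂̄_β f, ∂_γ f, ∂̄_δ f)`, whereas the asserted identity has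
`β` and `δ` exchanged. By the Bianchi identity and skewness (`riemannQuad_eq_add`) the two differ by
`R^N(∂̄_β f, ∂̄_δ f, ∂_α f, ∂_γ f)`. This vanishes: it is the commutator of `∇_β̄` and `∇_δ̄` on
`∂_α f`, which both operators annihilate (`IsPluriharmonicOn.riemannQuad_eq_zero`).

The coordinate identity is `IsPluriharmonicOn.hessian_localEnergy`. It passes to the manifold
through `energy_eq_localEnergy`, which rests on the independence of the trace from the basis. -/

noncomputable section

namespace ChernLu

/-! ### Differentiation along complexified vectors. -/

section Calculus

variable {E : Type*} [NormedAddCommGroup E] [NormedSpace ℝ E]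

/-- The derivative of a complex valued function in the direction of the complexified vector
`X.1 + i X.2`. -/
def cderiv (X : E × E) (φ : E → ℂ) (z : E) : ℂ :=
  fderiv ℝ φ z X.1 + Complex.I * fderiv ℝ φ z X.2

lemma cderiv_congr {X : E × E} {φ ψ : E → ℂ} {z : E} (h : φ =ᶠ[nhds z] ψ) :
    cderiv X φ z = cderiv X ψ z := by
  simp only [cderiv, h.fderiv_eq]

lemma cderiv_congr_of_isOpen {X : E × E} {φ ψ : E → ℂ} {U : Set E} (hU : IsOpen U)
    (h : ∀ z ∈ U, φ z = ψ z) {z : E} (hz : z ∈ U) : cderiv X φ z = cderiv X ψ z :=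
  cderiv_congr (Filter.eventuallyEq_of_mem (hU.mem_nhds hz) h)

@[simp] lemma cderiv_const (X : E × E) (c : ℂ) (z : E) : cderiv X (fun _ => c) z = 0 := by
  simp [cderiv]

lemma cderiv_add {X : E × E} {φ ψ : E → ℂ} {z : E} (hφ : DifferentiableAt ℝ φ z)
    (hψ : DifferentiableAt ℝ ψ z) :
    cderiv X (fun w => φ w + ψ w) z = cderiv X φ z + cderiv X ψ z := by
  simp only [cderiv, fderiv_fun_add hφ hψ, add_apply]
  ring

lemma cderiv_sub {X : E × E} {φ ψ : E → ℂ} {z : E} (hφ : DifferentiableAt ℝ φ z)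
    (hψ : DifferentiableAt ℝ ψ z) :
    cderiv X (fun w => φ w - ψ w) z = cderiv X φ z - cderiv X ψ z := by
  simp only [cderiv, fderiv_fun_sub hφ hψ, sub_apply]
  ring

lemma cderiv_mul {X : E × E} {φ ψ : E → ℂ} {z : E} (hφ : DifferentiableAt ℝ φ z)
    (hψ : DifferentiableAt ℝ ψ z) :
    cderiv X (fun w => φ w * ψ w) z = cderiv X φ z * ψ z + φ z * cderiv X ψ z := by
  simp only [cderiv, fderiv_fun_mul hφ hψ, add_apply, smul_apply, smul_eq_mul]
  ring

lemma cderiv_sum {ι : Type*} {s : Finset ι} {X : E × E} {φ : ι → E → ℂ} {z : E}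
    (hφ : ∀ i ∈ s, DifferentiableAt ℝ (φ i) z) :
    cderiv X (fun w => ∑ i ∈ s, φ i w) z = ∑ i ∈ s, cderiv X (φ i) z := by
  simp only [cderiv, fderiv_fun_sum hφ, sum_apply, Finset.mul_sum,
    Finset.sum_add_distrib]

lemma conj_cderiv (X : E × E) (φ : E → ℂ) (z : E) :
    conj (cderiv X φ z) = cderiv (X.1, -X.2) (fun w => conj (φ w)) z := by
  have h : fderiv ℝ (fun w => conj (φ w)) z =
      (Complex.conjCLE : ℂ →L[ℝ] ℂ).comp (fderiv ℝ φ z) :=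
    Complex.conjCLE.comp_fderiv
  simp [cderiv, h]

lemma _root_.ContDiffOn.cderiv {U : Set E} (hU : IsOpen U) {φ : E → ℂ}
    (hφ : ContDiffOn ℝ ∞ φ U) (X : E × E) : ContDiffOn ℝ ∞ (cderiv X φ) U := by
  have h : ContDiffOn ℝ ∞ (fderiv ℝ φ) U := hφ.fderiv_of_isOpen hU (by simp)
  exact (h.clm_apply contDiffOn_const).add
    (contDiffOn_const.mul (h.clm_apply contDiffOn_const))

lemma _root_.ContDiffOn.differentiableAt_of_isOpen {F : Type*} [NormedAddCommGroup F]
    [NormedSpace ℝ F] {U : Set E} (hU : IsOpen U) {φ : E → F}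
    (hφ : ContDiffOn ℝ ∞ φ U) {z : E} (hz : z ∈ U) : DifferentiableAt ℝ φ z :=
  (hφ.contDiffAt (hU.mem_nhds hz)).differentiableAt (by simp)

lemma cderiv_comm {U : Set E} (hU : IsOpen U) {φ : E → ℂ} (hφ : ContDiffOn ℝ ∞ φ U)
    {z : E} (hz : z ∈ U) (X Y : E × E) :
    cderiv X (cderiv Y φ) z = cderiv Y (cderiv X φ) z := by
  have h : ContDiffOn ℝ ∞ (fderiv ℝ φ) U := hφ.fderiv_of_isOpen hU (by simp)
  have hd := h.differentiableAt_of_isOpen hU hz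
  have hs : IsSymmSndFDerivAt ℝ φ z :=
    (hφ.contDiffAt (hU.mem_nhds hz)).isSymmSndFDerivAt (by
      simpa using WithTop.coe_le_coe.2 (le_top : (2 : ℕ∞) ≤ ⊤))
  have key (X Y : E × E) : cderiv X (cderiv Y φ) z =
      fderiv ℝ (fderiv ℝ φ) z X.1 Y.1 + Complex.I * fderiv ℝ (fderiv ℝ φ) z X.1 Y.2 +
      Complex.I * (fderiv ℝ (fderiv ℝ φ) z X.2 Y.1 +
        Complex.I * fderiv ℝ (fderiv ℝ φ) z X.2 Y.2) := by
    have h1 (v : E) : DifferentiableAt ℝ (fun w => fderiv ℝ φ w v) z :=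
      hd.clm_apply (differentiableAt_const _)
    have h2 : fderiv ℝ (cderiv Y φ) z = fderiv ℝ (fun w => fderiv ℝ φ w Y.1) z +
        Complex.I • fderiv ℝ (fun w => fderiv ℝ φ w Y.2) z := by
      have : cderiv Y φ = fun w => fderiv ℝ φ w Y.1 + Complex.I * fderiv ℝ φ w Y.2 := rfl
      rw [this, fderiv_fun_add (h1 _) ((h1 _).const_mul _), fderiv_const_mul (h1 _)]
    have h3 (v : E) : fderiv ℝ (fun w => fderiv ℝ φ w v) z =
        (fderiv ℝ (fderiv ℝ φ) z).flip v := by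
      rw [fderiv_clm_apply hd (differentiableAt_const _)]
      simp
    rw [cderiv, h2, h3, h3]
    simp
  rw [key, key, hs.eq X.1 Y.1, hs.eq X.1 Y.2, hs.eq X.2 Y.1, hs.eq X.2 Y.2]
  ring

lemma fderiv_ofReal_comp {φ : E → ℝ} {z : E} (hφ : DifferentiableAt ℝ φ z) (v : E) :
    fderiv ℝ (fun w => ((φ w : ℝ) : ℂ)) z v = (fderiv ℝ φ z v : ℂ) := by
  have := (Complex.ofRealCLM.hasFDerivAt.comp z hφ.hasFDerivAt).fderiv
  have h2 : (fun w => ((φ w : ℝ) : ℂ)) = Complex.ofRealCLM ∘ φ := rfl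
  rw [h2, this]
  simp

lemma fderiv_apply_eq_sum_dely {n : ℕ} (φ : RE n → ℝ) (y v : RE n) :
    fderiv ℝ φ y v = ∑ j, dely j φ y * v j := by
  conv_lhs => rw [← (EuclideanSpace.basisFun (Fin n) ℝ).sum_repr v]
  simp [dely, mul_comm]

lemma cderiv_comp_real {n : ℕ} {φ : RE n → ℝ} {F : E → RE n} {z : E}
    (hφ : DifferentiableAt ℝ φ (F z)) (hF : DifferentiableAt ℝ F z) (X : E × E) :
    cderiv X (fun w => ((φ (F w) : ℝ) : ℂ)) z =
      ∑ j, (dely j φ (F z) : ℂ) * cderiv X (fun w => ((F w j : ℝ) : ℂ)) z := by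
  have h1 (v : E) : fderiv ℝ (fun w => ((φ (F w) : ℝ) : ℂ)) z v =
      ∑ j, (dely j φ (F z) : ℂ) * fderiv ℝ (fun w => ((F w j : ℝ) : ℂ)) z v := by
    rw [fderiv_ofReal_comp (φ := fun w => φ (F w)) (hφ.comp z hF)]
    have h2 : fderiv ℝ (fun w => φ (F w)) z = (fderiv ℝ φ (F z)).comp (fderiv ℝ F z) :=
      fderiv_comp z hφ hF
    rw [h2, ContinuousLinearMap.comp_apply, fderiv_apply_eq_sum_dely]
    push_cast
    refine Finset.sum_congr rfl fun j _ => ?_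
    have h3 : DifferentiableAt ℝ (fun w => F w j) z := differentiableAt_euclidean.1 hF j
    rw [fderiv_ofReal_comp h3]
    have h4 : fderiv ℝ (fun w => F w j) z =
        (EuclideanSpace.proj j : RE n →L[ℝ] ℝ).comp (fderiv ℝ F z) :=
      ((EuclideanSpace.proj j : RE n →L[ℝ] ℝ).hasFDerivAt.comp z hF.hasFDerivAt).fderiv
    rw [h4]
    simp
  simp only [cderiv, h1, Finset.mul_sum, ← Finset.sum_add_distrib]
  exact Finset.sum_congr rfl fun j _ => by ring

lemma _root_.ContDiffOn.ofReal_comp {U : Set E} {φ : E → ℝ} (hφ : ContDiffOn ℝ ∞ φ U) :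
    ContDiffOn ℝ ∞ (fun w => ((φ w : ℝ) : ℂ)) U :=
  Complex.ofRealCLM.contDiff.comp_contDiffOn hφ

/-- Cramer's rule: the entries are polynomials in the entries of `A` divided by the determinant. -/
lemma contDiffOn_matrix_inv {𝕜 : Type*} [RCLike 𝕜] {ι : Type*} [Fintype ι] [DecidableEq ι]
    {U : Set E} {A : E → Matrix ι ι 𝕜} (hA : ∀ i j, ContDiffOn ℝ ∞ (fun z => A z i j) U)
    (hdet : ∀ z ∈ U, IsUnit (A z).det) (i j : ι) :
    ContDiffOn ℝ ∞ (fun z => (A z)⁻¹ i j) U := by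
  have hd (B : E → Matrix ι ι 𝕜) (hB : ∀ i j, ContDiffOn ℝ ∞ (fun z => B z i j) U) :
      ContDiffOn ℝ ∞ (fun z => (B z).det) U := by
    simp only [Matrix.det_apply]
    refine ContDiffOn.sum fun σ _ => ?_
    refine ContDiffOn.const_smul _ (contDiffOn_prod fun i _ => hB _ _)
  have hadj : ContDiffOn ℝ ∞ (fun z => (A z).adjugate i j) U := by
    simp only [Matrix.adjugate_apply]
    refine hd _ fun k l => ?_
    by_cases hk : k = j
    · subst hk
      simpa using contDiffOn_const
    · simpa [Matrix.updateRow_ne hk] using hA k l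
  have : ∀ z, (A z)⁻¹ i j = ((A z).det)⁻¹ * (A z).adjugate i j := fun z => by
    simp [Matrix.inv_def]
  simp only [this]
  exact ((hd A hA).inv fun z hz => (hdet z hz).ne_zero).mul hadj

end Calculus

/-! ### The Levi-Civita connection in coordinates. -/

/-- `G` is the coordinate matrix of a smooth nondegenerate symmetric 2-tensor on the open
set `V`. -/
structure IsMetricOn {n : ℕ} (G : RE n → Matrix (Fin n) (Fin n) ℝ) (V : Set (RE n)) : Prop where
  isOpen : IsOpen V
  smooth : ∀ i j, ContDiffOn ℝ ∞ (fun y => G y i j) V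
  symm : ∀ y ∈ V, ∀ i j, G y i j = G y j i
  isUnit_det : ∀ y ∈ V, IsUnit (G y).det

namespace IsMetricOn

variable {n : ℕ} {G : RE n → Matrix (Fin n) (Fin n) ℝ} {V : Set (RE n)}

lemma contDiffOn_dely {V : Set (RE n)} (hV : IsOpen V) {φ : RE n → ℝ} (hφ : ContDiffOn ℝ ∞ φ V)
    (i : Fin n) : ContDiffOn ℝ ∞ (dely i φ) V :=
  (hφ.fderiv_of_isOpen hV (by simp) : ContDiffOn ℝ ∞ (fderiv ℝ φ) V).clm_apply contDiffOn_const

lemma dely_symm (hG : IsMetricOn G V) {y : RE n} (hy : y ∈ V) (i j k : Fin n) :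
    dely k (fun x => G x i j) y = dely k (fun x => G x j i) y := by
  have : (fun x => G x i j) =ᶠ[nhds y] (fun x => G x j i) :=
    Filter.eventuallyEq_of_mem (hG.isOpen.mem_nhds hy) fun x hx => hG.symm x hx i j
  simp only [dely, this.fderiv_eq]

lemma christoffel_symm (hG : IsMetricOn G V) {y : RE n} (hy : y ∈ V) (k i j : Fin n) :
    christoffel G k i j y = christoffel G k j i y := by
  simp only [christoffel]
  congr 1
  refine Finset.sum_congr rfl fun l _ => ?_
  rw [hG.dely_symm hy i j l]
  ring

lemma contDiffOn_christoffel (hG : IsMetricOn G V) (k i j : Fin n) :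
    ContDiffOn ℝ ∞ (christoffel G k i j) V := by
  have h (l i j : Fin n) := contDiffOn_dely hG.isOpen (hG.smooth i j) l
  exact contDiffOn_const.mul (ContDiffOn.sum fun l _ =>
    (contDiffOn_matrix_inv hG.smooth hG.isUnit_det k l).mul
      (((h _ _ _).add (h _ _ _)).sub (h _ _ _)))

/-- Lowering the upper index cancels the inverse matrix in `christoffel` and leaves the Christoffel
symbols of the first kind. -/
lemma sum_mul_christoffel (hG : IsMetricOn G V) {y : RE n} (hy : y ∈ V) (i j k : Fin n) :
    ∑ p, G y k p * christoffel G p i j y = (1 / 2) * (dely i (fun x => G x j k) y +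
      dely j (fun x => G x i k) y - dely k (fun x => G x i j) y) := by
  have h : ∀ a : Fin n → ℝ, ∑ p, G y k p * ∑ l, (G y)⁻¹ p l * a l = a k := fun a => by
    have := congrFun (Matrix.mulVec_mulVec a (G y) (G y)⁻¹) k
    rw [Matrix.mul_nonsing_inv _ (hG.isUnit_det y hy), Matrix.one_mulVec] at this
    simpa [Matrix.mulVec, dotProduct] using this
  rw [← h fun l => (dely i (fun x => G x j l) y +
      dely j (fun x => G x i l) y - dely l (fun x => G x i j) y)]
  simp only [christoffel, Finset.mul_sum]
  refine Finset.sum_congr rfl fun p _ => Finset.sum_congr rfl fun l _ => ?_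
  ring

/-- The Levi-Civita connection is metric. -/
lemma dely_eq_sum (hG : IsMetricOn G V) {y : RE n} (hy : y ∈ V) (i j k : Fin n) :
    dely k (fun x => G x i j) y =
      ∑ p, (G y p j * christoffel G p k i y + G y i p * christoffel G p k j y) := by
  rw [Finset.sum_add_distrib, hG.sum_mul_christoffel hy]
  simp only [hG.symm y hy _ j]
  rw [hG.sum_mul_christoffel hy, hG.dely_symm hy j i, hG.dely_symm hy k j,
    hG.dely_symm hy k i]
  ring

end IsMetricOn

/-! ### The pull-back connection, its compatibility with the metric, and its curvature. -/

section PullbackConnection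

variable {E : Type*} [NormedAddCommGroup E] [NormedSpace ℝ E] {n : ℕ}

/-- The connection matrix of the pull-back by `F` of the Levi-Civita connection, evaluated on the
complexified vector `X`. -/
def connForm (G : RE n → Matrix (Fin n) (Fin n) ℝ) (F : E → RE n) (X : E × E) (i k : Fin n)
    (z : E) : ℂ :=
  ∑ j, (christoffel G i j k (F z) : ℂ) * cderiv X (fun w => ((F w j : ℝ) : ℂ)) z

/-- The covariant derivative in the direction `X` for the pull-back by `F` of the Levi-Civita
connection. -/
def pullbackConn (G : RE n → Matrix (Fin n) (Fin n) ℝ) (F : E → RE n) (X : E × E)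
    (s : Fin n → E → ℂ) (i : Fin n) (z : E) : ℂ :=
  cderiv X (s i) z + ∑ k, connForm G F X i k z * s k z

variable {G : RE n → Matrix (Fin n) (Fin n) ℝ} {V : Set (RE n)} {U : Set E} {F : E → RE n}

lemma contDiffOn_coord (hF : ContDiffOn ℝ ∞ F U) (j : Fin n) :
    ContDiffOn ℝ ∞ (fun w => ((F w j : ℝ) : ℂ)) U :=
  ((contDiffOn_euclidean.1 hF) j).ofReal_comp

lemma contDiffOn_connForm (hU : IsOpen U) (hG : IsMetricOn G V) (hF : ContDiffOn ℝ ∞ F U)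
    (hFV : Set.MapsTo F U V) (X : E × E) (i k : Fin n) :
    ContDiffOn ℝ ∞ (connForm G F X i k) U :=
  ContDiffOn.sum fun j _ => (((hG.contDiffOn_christoffel i j k).comp hF hFV).ofReal_comp).mul
    ((contDiffOn_coord hF j).cderiv hU X)

lemma contDiffOn_pullbackConn (hU : IsOpen U) (hG : IsMetricOn G V) (hF : ContDiffOn ℝ ∞ F U)
    (hFV : Set.MapsTo F U V) (X : E × E) {s : Fin n → E → ℂ}
    (hs : ∀ i, ContDiffOn ℝ ∞ (s i) U) (i : Fin n) :
    ContDiffOn ℝ ∞ (pullbackConn G F X s i) U :=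
  ((hs i).cderiv hU X).add (ContDiffOn.sum fun k _ =>
    (contDiffOn_connForm hU hG hF hFV X i k).mul (hs k))

lemma pullbackConn_congr (hU : IsOpen U) {s t : Fin n → E → ℂ}
    (h : ∀ i, ∀ z ∈ U, s i z = t i z) (X : E × E) (i : Fin n) {z : E} (hz : z ∈ U) :
    pullbackConn G F X s i z = pullbackConn G F X t i z := by
  simp only [pullbackConn, cderiv_congr_of_isOpen hU (h i) hz, h _ z hz]

/-- The connection coefficients are real, so conjugation acts only on the section and on the
direction. -/
lemma conj_pullbackConn (X : E × E) (s : Fin n → E → ℂ) (i : Fin n) (z : E) :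
    conj (pullbackConn G F X s i z) =
      pullbackConn G F (X.1, -X.2) (fun k w => conj (s k w)) i z := by
  simp [pullbackConn, connForm, conj_cderiv]

/-- The bilinear extension of the metric to sections of the complexified pull-back bundle. -/
def pairing (G : RE n → Matrix (Fin n) (Fin n) ℝ) (F : E → RE n) (s t : Fin n → E → ℂ)
    (z : E) : ℂ :=
  ∑ i, ∑ j, (G (F z) i j : ℂ) * s i z * t j z

lemma contDiffOn_metric_comp (hG : IsMetricOn G V) (hF : ContDiffOn ℝ ∞ F U)
    (hFV : Set.MapsTo F U V) (i j : Fin n) :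
    ContDiffOn ℝ ∞ (fun z => ((G (F z) i j : ℝ) : ℂ)) U :=
  ((hG.smooth i j).comp hF hFV).ofReal_comp

lemma contDiffOn_pairing (hG : IsMetricOn G V) (hF : ContDiffOn ℝ ∞ F U)
    (hFV : Set.MapsTo F U V) {s t : Fin n → E → ℂ} (hs : ∀ i, ContDiffOn ℝ ∞ (s i) U)
    (ht : ∀ i, ContDiffOn ℝ ∞ (t i) U) : ContDiffOn ℝ ∞ (pairing G F s t) U :=
  ContDiffOn.sum fun i _ => ContDiffOn.sum fun j _ =>
    ((contDiffOn_metric_comp hG hF hFV i j).mul (hs i)).mul (ht j)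

lemma cderiv_metric_comp (hU : IsOpen U) (hG : IsMetricOn G V) (hF : ContDiffOn ℝ ∞ F U)
    (hFV : Set.MapsTo F U V) {z : E} (hz : z ∈ U) (X : E × E) (i j : Fin n) :
    cderiv X (fun w => ((G (F w) i j : ℝ) : ℂ)) z =
      ∑ p, ((G (F z) p j : ℂ) * connForm G F X p i z +
        (G (F z) i p : ℂ) * connForm G F X p j z) := by
  rw [cderiv_comp_real (φ := fun y => G y i j)
    ((hG.smooth i j).differentiableAt_of_isOpen hG.isOpen (hFV hz))
    (hF.differentiableAt_of_isOpen hU hz)]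
  simp only [hG.dely_eq_sum (hFV hz), connForm, Finset.mul_sum, Complex.ofReal_sum,
    Finset.sum_mul, ← Finset.sum_add_distrib]
  rw [Finset.sum_comm]
  refine Finset.sum_congr rfl fun p _ => Finset.sum_congr rfl fun l _ => ?_
  push_cast
  ring

/-- The pull-back connection is metric. -/
lemma cderiv_pairing (hU : IsOpen U) (hG : IsMetricOn G V) (hF : ContDiffOn ℝ ∞ F U)
    (hFV : Set.MapsTo F U V) {s t : Fin n → E → ℂ} (hs : ∀ i, ContDiffOn ℝ ∞ (s i) U)
    (ht : ∀ i, ContDiffOn ℝ ∞ (t i) U) {z : E} (hz : z ∈ U) (X : E × E) :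
    cderiv X (pairing G F s t) z =
      pairing G F (pullbackConn G F X s) t z + pairing G F s (pullbackConn G F X t) z := by
  have hg (i j : Fin n) :=
    (contDiffOn_metric_comp hG hF hFV i j).differentiableAt_of_isOpen hU hz
  have hs' (i : Fin n) := (hs i).differentiableAt_of_isOpen hU hz
  have ht' (i : Fin n) := (ht i).differentiableAt_of_isOpen hU hz
  have h1 : cderiv X (pairing G F s t) z = ∑ i, ∑ j,
      (cderiv X (fun w => ((G (F w) i j : ℝ) : ℂ)) z * s i z * t j z +
        (G (F z) i j : ℂ) * cderiv X (s i) z * t j z +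
        (G (F z) i j : ℂ) * s i z * cderiv X (t j) z) := by
    unfold pairing
    rw [cderiv_sum fun i _ => DifferentiableAt.fun_sum fun j _ =>
      ((hg i j).fun_mul (hs' i)).fun_mul (ht' j)]
    refine Finset.sum_congr rfl fun i _ => ?_
    rw [cderiv_sum fun j _ => ((hg i j).fun_mul (hs' i)).fun_mul (ht' j)]
    refine Finset.sum_congr rfl fun j _ => ?_
    rw [cderiv_mul ((hg i j).fun_mul (hs' i)) (ht' j), cderiv_mul (hg i j) (hs' i)]
    ring
  rw [h1]
  simp only [cderiv_metric_comp hU hG hF hFV hz, pairing, pullbackConn, mul_add, add_mul,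
    Finset.sum_add_distrib, Finset.sum_mul, Finset.mul_sum]
  have e1 : ∑ i, ∑ j, ∑ p, (G (F z) p j : ℂ) * connForm G F X p i z * s i z * t j z =
      ∑ i, ∑ j, ∑ k, (G (F z) i j : ℂ) * (connForm G F X i k z * s k z) * t j z := by
    rw [Finset.sum_comm]
    conv_rhs => rw [Finset.sum_comm]
    refine Finset.sum_congr rfl fun j _ => ?_
    rw [Finset.sum_comm]
    refine Finset.sum_congr rfl fun i _ => Finset.sum_congr rfl fun k _ => ?_
    ring
  have e2 : ∑ i, ∑ j, ∑ p, (G (F z) i p : ℂ) * connForm G F X p j z * s i z * t j z =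
      ∑ i, ∑ j, ∑ k, (G (F z) i j : ℂ) * s i z * (connForm G F X j k z * t k z) := by
    refine Finset.sum_congr rfl fun i _ => ?_
    rw [Finset.sum_comm]
    refine Finset.sum_congr rfl fun j _ => Finset.sum_congr rfl fun k _ => ?_
    ring
  rw [e1, e2]
  ring

lemma cderiv_connForm (hU : IsOpen U) (hG : IsMetricOn G V) (hF : ContDiffOn ℝ ∞ F U)
    (hFV : Set.MapsTo F U V) {z : E} (hz : z ∈ U) (X Y : E × E) (i k : Fin n) :
    cderiv X (connForm G F Y i k) z =
      ∑ j, ∑ l, (dely j (christoffel G i l k) (F z) : ℂ) *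
        cderiv X (fun w => ((F w j : ℝ) : ℂ)) z * cderiv Y (fun w => ((F w l : ℝ) : ℂ)) z +
      ∑ j, (christoffel G i j k (F z) : ℂ) *
        cderiv X (cderiv Y (fun w => ((F w j : ℝ) : ℂ))) z := by
  have hc (j : Fin n) : DifferentiableAt ℝ
      (fun w => ((christoffel G i j k (F w) : ℝ) : ℂ)) z :=
    (((hG.contDiffOn_christoffel i j k).comp hF hFV).ofReal_comp).differentiableAt_of_isOpen hU hz
  have hY (j : Fin n) : DifferentiableAt ℝ (cderiv Y (fun w => ((F w j : ℝ) : ℂ))) z :=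
    ((contDiffOn_coord hF j).cderiv hU Y).differentiableAt_of_isOpen hU hz
  unfold connForm
  rw [cderiv_sum fun j _ => (hc j).fun_mul (hY j), Finset.sum_comm, ← Finset.sum_add_distrib]
  refine Finset.sum_congr rfl fun j _ => ?_
  rw [cderiv_mul (hc j) (hY j), cderiv_comp_real
    ((hG.contDiffOn_christoffel i j k).differentiableAt_of_isOpen hG.isOpen (hFV hz))
    (hF.differentiableAt_of_isOpen hU hz), Finset.sum_mul]

/-- In `riemannUp` the direction of differentiation is the last lower index of the Christoffel
symbols, in `connForm` it is the first. Torsion-freeness reconciles the two conventions. -/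
lemma riemannUp_eq (hG : IsMetricOn G V) {y : RE n} (hy : y ∈ V) (i j k l : Fin n) :
    riemannUp G i j k l y = dely i (christoffel G l j k) y - dely j (christoffel G l i k) y +
      ∑ p, (christoffel G l i p y * christoffel G p j k y -
        christoffel G l j p y * christoffel G p i k y) := by
  have h (a b c d : Fin n) : dely a (christoffel G b c d) y = dely a (christoffel G b d c) y := by
    have : christoffel G b c d =ᶠ[nhds y] christoffel G b d c :=
      Filter.eventuallyEq_of_mem (hG.isOpen.mem_nhds hy) fun x hx => hG.christoffel_symm hx b c d
    simp only [dely, this.fderiv_eq]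
  rw [riemannUp, h i l k j, h j l k i]
  congr 1
  refine Finset.sum_congr rfl fun p _ => ?_
  rw [hG.christoffel_symm hy p k j, hG.christoffel_symm hy p k i, hG.christoffel_symm hy l p i,
    hG.christoffel_symm hy l p j]
  ring

/-- The curvature form of the pull-back connection. -/
lemma curvature_connForm (hU : IsOpen U) (hG : IsMetricOn G V) (hF : ContDiffOn ℝ ∞ F U)
    (hFV : Set.MapsTo F U V) {z : E} (hz : z ∈ U) (X Y : E × E) (i k : Fin n) :
    cderiv X (connForm G F Y i k) z - cderiv Y (connForm G F X i k) z +
      ∑ p, (connForm G F X i p z * connForm G F Y p k z -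
        connForm G F Y i p z * connForm G F X p k z) =
      ∑ j, ∑ l, (riemannUp G j l k i (F z) : ℂ) *
        cderiv X (fun w => ((F w j : ℝ) : ℂ)) z * cderiv Y (fun w => ((F w l : ℝ) : ℂ)) z := by
  rw [cderiv_connForm hU hG hF hFV hz, cderiv_connForm hU hG hF hFV hz]
  simp only [cderiv_comm hU (contDiffOn_coord hF _) hz Y X, riemannUp_eq hG (hFV hz), connForm]
  -- The first derivatives of `F` become opaque vectors: apart from the second-derivative terms,
  -- both sides are bilinear in them.
  obtain ⟨x, hx⟩ : ∃ x : Fin n → ℂ, ∀ j, cderiv X (fun w => ((F w j : ℝ) : ℂ)) z = x j :=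
    ⟨_, fun _ => rfl⟩
  obtain ⟨y, hy⟩ : ∃ y : Fin n → ℂ, ∀ j, cderiv Y (fun w => ((F w j : ℝ) : ℂ)) z = y j :=
    ⟨_, fun _ => rfl⟩
  simp only [hx, hy]
  have e1 : ∑ j, ∑ l, (dely j (christoffel G i l k) (F z) : ℂ) * y j * x l =
      ∑ j, ∑ l, (dely l (christoffel G i j k) (F z) : ℂ) * x j * y l := by
    rw [Finset.sum_comm]
    exact Finset.sum_congr rfl fun j _ => Finset.sum_congr rfl fun l _ => by ring
  have e2 (a b : Fin n → ℂ) : ∑ p, (∑ j, (christoffel G i j p (F z) : ℂ) * a j) *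
      (∑ j, (christoffel G p j k (F z) : ℂ) * b j) =
      ∑ j, ∑ l, ∑ p, (christoffel G i j p (F z) : ℂ) * (christoffel G p l k (F z) : ℂ) *
        a j * b l := by
    simp only [Finset.sum_mul_sum]
    rw [Finset.sum_comm]
    refine Finset.sum_congr rfl fun j _ => ?_
    rw [Finset.sum_comm]
    refine Finset.sum_congr rfl fun l _ => Finset.sum_congr rfl fun p _ => by ring
  have e3 : ∑ j, ∑ l, ∑ p, (christoffel G i j p (F z) : ℂ) *
      (christoffel G p l k (F z) : ℂ) * y j * x l =
      ∑ j, ∑ l, ∑ p, (christoffel G i l p (F z) : ℂ) *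
      (christoffel G p j k (F z) : ℂ) * x j * y l := by
    rw [Finset.sum_comm]
    exact Finset.sum_congr rfl fun j _ => Finset.sum_congr rfl fun l _ =>
      Finset.sum_congr rfl fun p _ => by ring
  rw [Finset.sum_sub_distrib, e1, e2, e2, e3]
  -- The terms with second derivatives of `F` agree, since `X` and `Y` are constant and commute, and
  -- they cancel here.
  rw [add_sub_add_right_eq_sub]
  simp only [← Finset.sum_sub_distrib, ← Finset.sum_add_distrib]
  refine Finset.sum_congr rfl fun j _ => Finset.sum_congr rfl fun l _ => ?_
  push_cast
  rw [add_mul, add_mul, Finset.sum_mul, Finset.sum_mul]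
  congr 1
  · ring
  · exact Finset.sum_congr rfl fun p _ => by ring

/-- The curvature of the pull-back connection is the pull-back of the curvature. -/
lemma pullbackConn_commutator (hU : IsOpen U) (hG : IsMetricOn G V) (hF : ContDiffOn ℝ ∞ F U)
    (hFV : Set.MapsTo F U V) {s : Fin n → E → ℂ} (hs : ∀ i, ContDiffOn ℝ ∞ (s i) U)
    {z : E} (hz : z ∈ U) (X Y : E × E) (i : Fin n) :
    pullbackConn G F X (pullbackConn G F Y s) i z -
      pullbackConn G F Y (pullbackConn G F X s) i z =
      ∑ k, (∑ j, ∑ l, (riemannUp G j l k i (F z) : ℂ) *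
        cderiv X (fun w => ((F w j : ℝ) : ℂ)) z * cderiv Y (fun w => ((F w l : ℝ) : ℂ)) z) *
          s k z := by
  -- Everything in this expansion is symmetric in `X` and `Y` except the derivative of the
  -- connection matrix and the product of two such matrices. The commutator is therefore `dω + ω ∧
  -- ω`.
  have key (X Y : E × E) : pullbackConn G F X (pullbackConn G F Y s) i z =
      cderiv X (cderiv Y (s i)) z +
      ∑ k, (cderiv X (connForm G F Y i k) z * s k z + connForm G F Y i k z * cderiv X (s k) z +
        connForm G F X i k z * cderiv Y (s k) z) +
      ∑ k, (∑ p, connForm G F X i p z * connForm G F Y p k z) * s k z := by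
    have hω (k : Fin n) :=
      (contDiffOn_connForm hU hG hF hFV Y i k).differentiableAt_of_isOpen hU hz
    have hs' (k : Fin n) := (hs k).differentiableAt_of_isOpen hU hz
    have h1 : cderiv X (pullbackConn G F Y s i) z = cderiv X (cderiv Y (s i)) z +
        ∑ k, (cderiv X (connForm G F Y i k) z * s k z +
          connForm G F Y i k z * cderiv X (s k) z) := by
      have : pullbackConn G F Y s i = fun w => cderiv Y (s i) w +
        ∑ k, connForm G F Y i k w * s k w := rfl
      rw [this, cderiv_add (((hs i).cderiv hU Y).differentiableAt_of_isOpen hU hz)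
        (DifferentiableAt.fun_sum fun k _ => (hω k).fun_mul (hs' k)),
        cderiv_sum fun k _ => (hω k).fun_mul (hs' k)]
      congr 1
      exact Finset.sum_congr rfl fun k _ => cderiv_mul (hω k) (hs' k)
    have h2 : ∑ k, connForm G F X i k z * ∑ p, connForm G F Y k p z * s p z =
        ∑ k, (∑ p, connForm G F X i p z * connForm G F Y p k z) * s k z := by
      simp only [Finset.mul_sum, Finset.sum_mul]
      rw [Finset.sum_comm]
      exact Finset.sum_congr rfl fun j _ => Finset.sum_congr rfl fun l _ => by ring
    rw [pullbackConn, h1, ← h2]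
    simp only [pullbackConn, mul_add, Finset.sum_add_distrib]
    ring
  rw [key X Y, key Y X, cderiv_comm hU (hs i) hz Y X]
  simp only [← curvature_connForm hU hG hF hFV hz X Y i]
  rw [add_assoc, add_assoc, add_sub_add_left_eq_sub]
  simp only [← Finset.sum_add_distrib, ← Finset.sum_sub_distrib]
  refine Finset.sum_congr rfl fun k _ => ?_
  rw [Finset.sum_sub_distrib]
  ring

end PullbackConnection

/-! ### Symmetries of the Riemann tensor. -/

section Riemann

variable {n : ℕ} {G : RE n → Matrix (Fin n) (Fin n) ℝ} {V : Set (RE n)}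

lemma riemannUp_swap (G : RE n → Matrix (Fin n) (Fin n) ℝ) (i j k l : Fin n) (y : RE n) :
    riemannUp G i j k l y = -riemannUp G j i k l y := by
  simp only [riemannUp, Finset.sum_sub_distrib]
  ring

lemma riemann_swap (G : RE n → Matrix (Fin n) (Fin n) ℝ) (i j k l : Fin n) (y : RE n) :
    riemann G i j k l y = -riemann G j i k l y := by
  simp only [riemann, riemannUp_swap G i j, mul_neg, Finset.sum_neg_distrib]

/-- The first Bianchi identity. -/
lemma riemann_bianchi (hG : IsMetricOn G V) {y : RE n} (hy : y ∈ V) (i j k l : Fin n) :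
    riemann G i j k l y + riemann G j k i l y + riemann G k i j l y = 0 := by
  have h (s : Fin n) : riemannUp G i j k s y + riemannUp G j k i s y + riemannUp G k i j s y = 0 := by
    have hs (a b c d : Fin n) :
        dely a (christoffel G b c d) y = dely a (christoffel G b d c) y := by
      have : christoffel G b c d =ᶠ[nhds y] christoffel G b d c :=
        Filter.eventuallyEq_of_mem (hG.isOpen.mem_nhds hy)
          fun x hx => hG.christoffel_symm hx b c d
      simp only [dely, this.fderiv_eq]
    simp only [riemannUp, Finset.sum_sub_distrib]
    simp only [hs i s k j, hs j s i k, hs k s j i, hG.christoffel_symm hy _ k j,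
      hG.christoffel_symm hy _ i k, hG.christoffel_symm hy _ j i]
    ring
  simp only [riemann, ← Finset.sum_add_distrib, ← mul_add, h, mul_zero, Finset.sum_const_zero]

/-- The curvature operator is skew-symmetric. -/
lemma riemann_skew (hG : IsMetricOn G V) {y : RE n} (hy : y ∈ V) (i j k l : Fin n) :
    riemann G i j k l y = -riemann G i j l k y := by
  -- The pull-back machinery is applied to the identity map, real coordinate directions and the
  -- constant coordinate frame `s`. Second derivatives of `⟨s k, s l⟩` commute, so by metric
  -- compatibility the curvature operator is skew.
  let F : RE n → RE n := fun x => x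
  let X (i : Fin n) : RE n × RE n := (EuclideanSpace.single i 1, 0)
  let s (k : Fin n) : Fin n → RE n → ℂ := fun a _ => if a = k then 1 else 0
  have hF : ContDiffOn ℝ ∞ F V := contDiffOn_id
  have hFV : Set.MapsTo F V V := fun _ h => h
  have hs (k a : Fin n) : ContDiffOn ℝ ∞ (s k a) V := contDiffOn_const
  have hU := hG.isOpen
  have hc (X : RE n × RE n) (k : Fin n) (a : Fin n) :=
    contDiffOn_pullbackConn hU hG hF hFV X (hs k) a
  have hXF (i a : Fin n) : cderiv (X i) (fun w => ((F w a : ℝ) : ℂ)) y = if a = i then 1 else 0 := by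
    have h1 : DifferentiableAt ℝ (fun w : RE n => w a) y := by fun_prop
    have h2 : fderiv ℝ (fun w : RE n => w a) y = (EuclideanSpace.proj a : RE n →L[ℝ] ℝ) :=
      (EuclideanSpace.proj a : RE n →L[ℝ] ℝ).hasFDerivAt.fderiv
    simp only [cderiv, F, X, map_zero, mul_zero, add_zero]
    rw [fderiv_ofReal_comp h1, h2]
    by_cases h : a = i <;> simp [h]
  have hR (k a : Fin n) := pullbackConn_commutator hU hG hF hFV (hs k) hy (X i) (X j) a
  simp only [hXF] at hR
  have key (X Y : RE n × RE n) : cderiv X (cderiv Y (pairing G F (s k) (s l))) y =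
      pairing G F (pullbackConn G F X (pullbackConn G F Y (s k))) (s l) y +
      pairing G F (pullbackConn G F Y (s k)) (pullbackConn G F X (s l)) y +
      (pairing G F (pullbackConn G F X (s k)) (pullbackConn G F Y (s l)) y +
      pairing G F (s k) (pullbackConn G F X (pullbackConn G F Y (s l))) y) := by
    rw [cderiv_congr_of_isOpen hU
      (fun z hz => cderiv_pairing hU hG hF hFV (hs k) (hs l) hz Y) hy,
      cderiv_add, cderiv_pairing hU hG hF hFV (hc Y k) (hs l) hy,
      cderiv_pairing hU hG hF hFV (hs k) (hc Y l) hy]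
    · exact (contDiffOn_pairing hG hF hFV (hc Y k) (hs l)).differentiableAt_of_isOpen hU hy
    · exact (contDiffOn_pairing hG hF hFV (hs k) (hc Y l)).differentiableAt_of_isOpen hU hy
  have h0 := cderiv_comm hU (contDiffOn_pairing hG hF hFV (hs k) (hs l)) hy (X i) (X j)
  rw [key, key] at h0
  have h1 : pairing G F (pullbackConn G F (X i) (pullbackConn G F (X j) (s k))) (s l) y -
      pairing G F (pullbackConn G F (X j) (pullbackConn G F (X i) (s k))) (s l) y =
      riemann G i j k l y := by
    simp only [pairing, ← Finset.sum_sub_distrib, ← sub_mul, ← mul_sub, hR]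
    simp [s, F, riemann]
  have h2 : pairing G F (s k) (pullbackConn G F (X i) (pullbackConn G F (X j) (s l))) y -
      pairing G F (s k) (pullbackConn G F (X j) (pullbackConn G F (X i) (s l))) y =
      riemann G i j l k y := by
    simp only [pairing, ← Finset.sum_sub_distrib, ← mul_sub, hR]
    simp [s, F, riemann, hG.symm y hy k]
  have h3 : (riemann G i j k l y : ℂ) + riemann G i j l k y = 0 := by
    rw [← h1, ← h2]
    linear_combination h0
  exact eq_neg_of_add_eq_zero_left (by exact_mod_cast h3)

/-- `R_{ijkl} - R_{ilkj} = R_{jlik}`. -/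
lemma riemann_sub (hG : IsMetricOn G V) {y : RE n} (hy : y ∈ V) (i j k l : Fin n) :
    riemann G i j k l y - riemann G i l k j y = riemann G j l i k y := by
  -- Bianchi gives `R_{jlik} = -R_{ijlk} - R_{lijk}`. Skewness in either pair turns the right side
  -- into `R_{ijkl} - R_{ilkj}`, so pair symmetry is not required.
  have h1 := riemann_bianchi hG hy i j l k
  have h2 := riemann_skew hG hy i j k l
  have h3 := riemann_skew hG hy i l k j
  have h4 := riemann_swap G i l j k y
  linarith

end Riemann

/-! ### The Hermitian metric and its Chern connection in coordinates. -/

section Hermitian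

variable {m : ℕ}

/-- The complexified vector `∂/∂z^α`. -/
def zvec (α : Fin m) : CE m × CE m :=
  ((1 / 2 : ℝ) • EuclideanSpace.single α (1 : ℂ),
    -((1 / 2 : ℝ) • EuclideanSpace.single α Complex.I))

/-- The complexified vector `∂/∂z̄^α`. -/
def zbarvec (α : Fin m) : CE m × CE m :=
  ((1 / 2 : ℝ) • EuclideanSpace.single α (1 : ℂ),
    (1 / 2 : ℝ) • EuclideanSpace.single α Complex.I)

lemma delz_eq (α : Fin m) : delz α = cderiv (zvec α) := by
  ext φ z
  simp [delz, cderiv, zvec]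
  ring

lemma delzbar_eq (α : Fin m) : delzbar α = cderiv (zbarvec α) := by
  ext φ z
  simp [delzbar, cderiv, zbarvec]
  ring

lemma zvec_conj (α : Fin m) : ((zvec α).1, -(zvec α).2) = zbarvec α := by
  simp [zvec, zbarvec]

/-- `H` is the coordinate matrix of a smooth nondegenerate Hermitian form on the open set `U`. -/
structure IsHermitianOn (H : CE m → Matrix (Fin m) (Fin m) ℂ) (U : Set (CE m)) : Prop where
  isOpen : IsOpen U
  smooth : ∀ α β, ContDiffOn ℝ ∞ (fun z => H z α β) U
  conj_symm : ∀ z ∈ U, ∀ α β, conj (H z α β) = H z β α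
  isUnit_det : ∀ z ∈ U, IsUnit (H z).det

variable {H : CE m → Matrix (Fin m) (Fin m) ℂ} {U : Set (CE m)}

lemma IsHermitianOn.contDiffOn_hInv (hH : IsHermitianOn H U) (γ δ : Fin m) :
    ContDiffOn ℝ ∞ (hInv H γ δ) U :=
  contDiffOn_matrix_inv hH.smooth hH.isUnit_det δ γ

lemma IsHermitianOn.conj_hInv (hH : IsHermitianOn H U) {z : CE m} (hz : z ∈ U) (γ δ : Fin m) :
    conj (hInv H γ δ z) = hInv H δ γ z := by
  have h : (H z).IsHermitian := by
    ext i j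
    simpa using hH.conj_symm z hz j i
  exact h.inv.apply γ δ

lemma IsHermitianOn.sum_hInv_mul (hH : IsHermitianOn H U) {z : CE m} (hz : z ∈ U) (γ μ : Fin m) :
    ∑ δ, hInv H γ δ z * H z μ δ = if μ = γ then 1 else 0 := by
  have := congrFun (congrFun (Matrix.mul_nonsing_inv _ (hH.isUnit_det z hz)) μ) γ
  rw [Matrix.mul_apply, Matrix.one_apply] at this
  rw [← this]
  exact Finset.sum_congr rfl fun δ _ => mul_comm _ _

/-- Differentiating `H⁻¹ H = 1` gives `(H⁻¹)' = -H⁻¹ H' H⁻¹`. The indices look exchanged because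
`hInv H γ δ` is the `(δ, γ)` entry of the inverse. -/
lemma IsHermitianOn.cderiv_hInv (hH : IsHermitianOn H U) {z : CE m} (hz : z ∈ U)
    (X : CE m × CE m) (γ δ : Fin m) : cderiv X (hInv H γ δ) z =
      -∑ μ, (∑ ν, hInv H γ ν z * cderiv X (fun w => H w μ ν) z) * hInv H μ δ z := by
  let K' : Matrix (Fin m) (Fin m) ℂ := Matrix.of fun a b => cderiv X (fun w => (H w)⁻¹ a b) z
  let H' : Matrix (Fin m) (Fin m) ℂ := Matrix.of fun a b => cderiv X (fun w => H w a b) z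
  have hK (a b : Fin m) := (contDiffOn_matrix_inv hH.smooth hH.isUnit_det a
    b).differentiableAt_of_isOpen hH.isOpen hz
  have hHd (a b : Fin m) := (hH.smooth a b).differentiableAt_of_isOpen hH.isOpen hz
  have h1 : K' * H z + (H z)⁻¹ * H' = 0 := by
    ext a b
    have h2 : cderiv X (fun w => ∑ c, (H w)⁻¹ a c * H w c b) z =
        cderiv X (fun _ => (1 : Matrix (Fin m) (Fin m) ℂ) a b) z :=
      cderiv_congr_of_isOpen hH.isOpen (fun w hw => by
        rw [← Matrix.nonsing_inv_mul _ (hH.isUnit_det w hw), Matrix.mul_apply]) hz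
    rw [cderiv_const, cderiv_sum fun c _ => (hK a c).fun_mul (hHd c b)] at h2
    simp only [cderiv_mul (hK _ _) (hHd _ _), Finset.sum_add_distrib] at h2
    simpa [Matrix.mul_apply, K', H'] using h2
  have h3 : K' = -((H z)⁻¹ * H' * (H z)⁻¹) := by
    rw [← add_eq_zero_iff_eq_neg]
    calc K' + (H z)⁻¹ * H' * (H z)⁻¹ = (K' * H z + (H z)⁻¹ * H') * (H z)⁻¹ := by
          rw [add_mul, mul_assoc K', Matrix.mul_nonsing_inv _ (hH.isUnit_det z hz), mul_one]
      _ = 0 := by rw [h1, zero_mul]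
  have h4 := congrFun (congrFun h3 δ) γ
  change cderiv X (fun w => (H w)⁻¹ δ γ) z = _
  rw [show cderiv X (fun w => (H w)⁻¹ δ γ) z = K' δ γ from rfl, h4, Matrix.neg_apply, mul_assoc,
    Matrix.mul_apply]
  congr 1
  refine Finset.sum_congr rfl fun μ _ => ?_
  rw [mul_comm, Matrix.mul_apply]
  congr 1
  exact Finset.sum_congr rfl fun ν _ => mul_comm _ _

/-- The inner sum of `cderiv_hInv` is the definition of the Chern coefficient. Thus a `(1,0)`
derivative of the inverse metric involves a correction in the unbarred index only. -/
lemma IsHermitianOn.delz_hInv (hH : IsHermitianOn H U) {z : CE m} (hz : z ∈ U)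
    (α γ δ : Fin m) :
    cderiv (zvec α) (hInv H γ δ) z = -∑ μ, chernConn H γ α μ z * hInv H μ δ z := by
  simp only [hH.cderiv_hInv hz, chernConn, delz_eq]

/-- Conjugate of `delz_hInv`; the correction moves to the barred index. -/
lemma IsHermitianOn.delzbar_hInv (hH : IsHermitianOn H U) {z : CE m} (hz : z ∈ U)
    (β γ δ : Fin m) :
    cderiv (zbarvec β) (hInv H γ δ) z = -∑ ν, conj (chernConn H δ β ν z) * hInv H γ ν z := by
  have h := congrArg conj (hH.delz_hInv hz β δ γ)
  rw [conj_cderiv, zvec_conj,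
    cderiv_congr_of_isOpen hH.isOpen (fun w hw => hH.conj_hInv hw δ γ) hz] at h
  simpa [hH.conj_hInv hz] using h

lemma IsHermitianOn.contDiffOn_chernConn (hH : IsHermitianOn H U) (μ α γ : Fin m) :
    ContDiffOn ℝ ∞ (chernConn H μ α γ) U := by
  unfold chernConn
  simp only [delz_eq]
  exact ContDiffOn.sum fun ν _ => (hH.contDiffOn_hInv μ ν).mul
    ((hH.smooth γ ν).cderiv hH.isOpen _)

end Hermitian

/-! ### Multilinear algebra of the pairing and of the curvature tensor. -/

section Pairing

variable {E : Type*} {n : ℕ} {ι : Type*} [Fintype ι]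

lemma pairing_sub_left (G : RE n → Matrix (Fin n) (Fin n) ℝ) (F : E → RE n)
    (a b t : Fin n → E → ℂ) (z : E) :
    pairing G F (fun i w => a i w - b i w) t z = pairing G F a t z - pairing G F b t z := by
  simp only [pairing, mul_sub, sub_mul, Finset.sum_sub_distrib]

lemma pairing_sum_left (G : RE n → Matrix (Fin n) (Fin n) ℝ) (F : E → RE n)
    (t : Fin n → E → ℂ) (c : ι → E → ℂ) (s : ι → Fin n → E → ℂ) (z : E) :
    pairing G F (fun i w => ∑ κ, c κ w * s κ i w) t z =
      ∑ κ, c κ z * pairing G F (s κ) t z := by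
  simp only [pairing, Finset.mul_sum, Finset.sum_mul]
  conv_rhs => rw [Finset.sum_comm]
  refine Finset.sum_congr rfl fun i _ => ?_
  rw [Finset.sum_comm]
  exact Finset.sum_congr rfl fun κ _ => Finset.sum_congr rfl fun j _ => by ring

lemma pairing_sub_sum_left (G : RE n → Matrix (Fin n) (Fin n) ℝ) (F : E → RE n)
    (a t : Fin n → E → ℂ) (c : ι → E → ℂ) (s : ι → Fin n → E → ℂ) (z : E) :
    pairing G F (fun i w => a i w - ∑ κ, c κ w * s κ i w) t z =
      pairing G F a t z - ∑ κ, c κ z * pairing G F (s κ) t z := by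
  rw [← pairing_sum_left, ← pairing_sub_left]

lemma pairing_sub_sum_right (G : RE n → Matrix (Fin n) (Fin n) ℝ) (F : E → RE n)
    (t a : Fin n → E → ℂ) (c : ι → E → ℂ) (s : ι → Fin n → E → ℂ) (z : E) :
    pairing G F t (fun i w => a i w - ∑ κ, c κ w * s κ i w) z =
      pairing G F t a z - ∑ κ, c κ z * pairing G F t (s κ) z := by
  simp only [pairing, mul_sub, Finset.sum_sub_distrib, Finset.mul_sum]
  congr 1
  conv_rhs => rw [Finset.sum_comm]
  refine Finset.sum_congr rfl fun i _ => ?_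
  rw [Finset.sum_comm]
  exact Finset.sum_congr rfl fun κ _ => Finset.sum_congr rfl fun j _ => by ring

/-- The complex multilinear extension of the Riemann tensor. -/
def riemannQuad (G : RE n → Matrix (Fin n) (Fin n) ℝ) (y : RE n) (a b c d : Fin n → ℂ) : ℂ :=
  ∑ i, ∑ j, ∑ k, ∑ l, (riemann G i j k l y : ℂ) * a i * b j * c k * d l

lemma riemannQuad_swap (G : RE n → Matrix (Fin n) (Fin n) ℝ) (y : RE n) (a b c d : Fin n → ℂ) :
    riemannQuad G y a b c d = -riemannQuad G y b a c d := by
  simp only [riemannQuad, ← Finset.sum_neg_distrib]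
  rw [Finset.sum_comm]
  refine Finset.sum_congr rfl fun i _ => Finset.sum_congr rfl fun j _ =>
    Finset.sum_congr rfl fun k _ => Finset.sum_congr rfl fun l _ => ?_
  rw [riemann_swap G j i]
  push_cast
  ring

/-- Complex multilinear form of `riemann_sub`; the long sums only relabel indices. It exchanges `b`
and `d` at the price of a term that pluriharmonicity will annihilate. -/
lemma riemannQuad_eq_add {G : RE n → Matrix (Fin n) (Fin n) ℝ} {V : Set (RE n)}
    (hG : IsMetricOn G V) {y : RE n} (hy : y ∈ V) (a b c d : Fin n → ℂ) :
    riemannQuad G y a b c d = riemannQuad G y a d c b + riemannQuad G y b d a c := by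
  have h1 : riemannQuad G y a d c b =
      ∑ i, ∑ j, ∑ k, ∑ l, (riemann G i l k j y : ℂ) * a i * b j * c k * d l := by
    refine Finset.sum_congr rfl fun i _ => ?_
    calc _ = ∑ l, ∑ j, ∑ k, (riemann G i l k j y : ℂ) * a i * d l * c k * b j :=
          Finset.sum_congr rfl fun l _ => Finset.sum_comm
      _ = ∑ j, ∑ l, ∑ k, (riemann G i l k j y : ℂ) * a i * d l * c k * b j := Finset.sum_comm
      _ = ∑ j, ∑ k, ∑ l, (riemann G i l k j y : ℂ) * a i * d l * c k * b j :=
          Finset.sum_congr rfl fun l _ => Finset.sum_comm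
      _ = _ := Finset.sum_congr rfl fun j _ => Finset.sum_congr rfl fun k _ =>
          Finset.sum_congr rfl fun l _ => by ring
  have h2 : riemannQuad G y b d a c =
      ∑ i, ∑ j, ∑ k, ∑ l, (riemann G j l i k y : ℂ) * a i * b j * c k * d l := by
    calc _ = ∑ j, ∑ i, ∑ l, ∑ k, (riemann G j l i k y : ℂ) * b j * d l * a i * c k :=
          Finset.sum_congr rfl fun l _ => Finset.sum_comm
      _ = ∑ i, ∑ j, ∑ l, ∑ k, (riemann G j l i k y : ℂ) * b j * d l * a i * c k :=
          Finset.sum_comm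
      _ = ∑ i, ∑ j, ∑ k, ∑ l, (riemann G j l i k y : ℂ) * b j * d l * a i * c k :=
          Finset.sum_congr rfl fun i _ => Finset.sum_congr rfl fun j _ => Finset.sum_comm
      _ = _ := Finset.sum_congr rfl fun i _ => Finset.sum_congr rfl fun j _ =>
          Finset.sum_congr rfl fun k _ => Finset.sum_congr rfl fun l _ => by ring
  rw [h1, h2]
  simp only [riemannQuad, ← Finset.sum_add_distrib]
  refine Finset.sum_congr rfl fun i _ => Finset.sum_congr rfl fun j _ =>
    Finset.sum_congr rfl fun k _ => Finset.sum_congr rfl fun l _ => ?_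
  rw [← riemann_sub hG hy i j k l]
  push_cast
  ring

/-- Pairing with `t` lowers the upper index, turning the curvature operator produced by
`pullbackConn_commutator` into the curvature tensor. -/
lemma pairing_riemannUp (G : RE n → Matrix (Fin n) (Fin n) ℝ) (F : E → RE n) (z : E)
    (a b c : Fin n → E → ℂ) (t : Fin n → E → ℂ) :
    pairing G F (fun i w => ∑ k, (∑ j, ∑ l, (riemannUp G j l k i (F w) : ℂ) *
      a j w * b l w) * c k w) t z =
    riemannQuad G (F z) (fun j => a j z) (fun j => b j z) (fun j => c j z) (fun j => t j z) := by
  simp only [pairing, riemannQuad, riemann, Complex.ofReal_sum, Finset.mul_sum, Finset.sum_mul]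
  calc ∑ i, ∑ q, ∑ k, ∑ j, ∑ l, (G (F z) i q : ℂ) *
        ((riemannUp G j l k i (F z) : ℂ) * a j z * b l z * c k z) * t q z
      = ∑ i, ∑ q, ∑ j, ∑ k, ∑ l, (G (F z) i q : ℂ) *
        ((riemannUp G j l k i (F z) : ℂ) * a j z * b l z * c k z) * t q z :=
        Finset.sum_congr rfl fun i _ => Finset.sum_congr rfl fun q _ => Finset.sum_comm
    _ = ∑ i, ∑ j, ∑ q, ∑ k, ∑ l, (G (F z) i q : ℂ) *
        ((riemannUp G j l k i (F z) : ℂ) * a j z * b l z * c k z) * t q z :=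
        Finset.sum_congr rfl fun i _ => Finset.sum_comm
    _ = ∑ j, ∑ i, ∑ q, ∑ k, ∑ l, (G (F z) i q : ℂ) *
        ((riemannUp G j l k i (F z) : ℂ) * a j z * b l z * c k z) * t q z := Finset.sum_comm
    _ = ∑ j, ∑ l, ∑ k, ∑ q, ∑ i, (G (F z) i q : ℂ) *
        ((riemannUp G j l k i (F z) : ℂ) * a j z * b l z * c k z) * t q z := by
        refine Finset.sum_congr rfl fun j _ => ?_
        rw [Finset.sum_comm]
        calc _ = ∑ q, ∑ k, ∑ i, ∑ l, (G (F z) i q : ℂ) *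
                ((riemannUp G j l k i (F z) : ℂ) * a j z * b l z * c k z) * t q z :=
              Finset.sum_congr rfl fun q _ => Finset.sum_comm
          _ = ∑ k, ∑ q, ∑ i, ∑ l, (G (F z) i q : ℂ) *
                ((riemannUp G j l k i (F z) : ℂ) * a j z * b l z * c k z) * t q z :=
              Finset.sum_comm
          _ = ∑ k, ∑ q, ∑ l, ∑ i, (G (F z) i q : ℂ) *
                ((riemannUp G j l k i (F z) : ℂ) * a j z * b l z * c k z) * t q z :=
              Finset.sum_congr rfl fun k _ => Finset.sum_congr rfl fun q _ => Finset.sum_comm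
          _ = ∑ k, ∑ l, ∑ q, ∑ i, (G (F z) i q : ℂ) *
                ((riemannUp G j l k i (F z) : ℂ) * a j z * b l z * c k z) * t q z :=
              Finset.sum_congr rfl fun k _ => Finset.sum_comm
          _ = _ := Finset.sum_comm
    _ = _ := by
        refine Finset.sum_congr rfl fun j _ => Finset.sum_congr rfl fun l _ =>
          Finset.sum_congr rfl fun k _ => Finset.sum_congr rfl fun q _ =>
          Finset.sum_congr rfl fun i _ => ?_
        push_cast
        ring

end Pairing

/-! ### The Chern–Lu identity in coordinates. -/

section LocalFormula

variable {m n : ℕ} {H : CE m → Matrix (Fin m) (Fin m) ℂ} {U : Set (CE m)}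
  {G : RE n → Matrix (Fin n) (Fin n) ℝ} {V : Set (RE n)} {F : CE m → RE n}

lemma nablaE_eq_pullbackConn (G : RE n → Matrix (Fin n) (Fin n) ℝ) (F : CE m → RE n)
    (s : Fin n → CE m → ℂ) (α : Fin m) (i : Fin n) (z : CE m) :
    nablaE G F s α i z = pullbackConn G F (zvec α) s i z := by
  simp only [nablaE, pullbackConn, connForm, delz_eq, delF, Finset.sum_mul]
  rw [Finset.sum_comm]

/-- The trace of `G(s_γ, t_δ̄)` with respect to the Hermitian metric. -/
def traceForm (H : CE m → Matrix (Fin m) (Fin m) ℂ) (G : RE n → Matrix (Fin n) (Fin n) ℝ)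
    (F : CE m → RE n) (s t : Fin m → Fin n → CE m → ℂ) (z : CE m) : ℂ :=
  ∑ γ, ∑ δ, hInv H γ δ z * pairing G F (s γ) (t δ) z

lemma contDiffOn_traceForm (hH : IsHermitianOn H U) (hG : IsMetricOn G V)
    (hF : ContDiffOn ℝ ∞ F U) (hFV : Set.MapsTo F U V) {s t : Fin m → Fin n → CE m → ℂ}
    (hs : ∀ γ i, ContDiffOn ℝ ∞ (s γ i) U) (ht : ∀ γ i, ContDiffOn ℝ ∞ (t γ i) U) :
    ContDiffOn ℝ ∞ (traceForm H G F s t) U :=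
  ContDiffOn.sum fun γ _ => ContDiffOn.sum fun δ _ =>
    (hH.contDiffOn_hInv γ δ).mul (contDiffOn_pairing hG hF hFV (hs γ) (ht δ))

lemma cderiv_traceForm (hH : IsHermitianOn H U) (hG : IsMetricOn G V)
    (hF : ContDiffOn ℝ ∞ F U) (hFV : Set.MapsTo F U V) {s t : Fin m → Fin n → CE m → ℂ}
    (hs : ∀ γ i, ContDiffOn ℝ ∞ (s γ i) U) (ht : ∀ γ i, ContDiffOn ℝ ∞ (t γ i) U)
    {z : CE m} (hz : z ∈ U) (X : CE m × CE m) :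
    cderiv X (traceForm H G F s t) z =
      ∑ γ, ∑ δ, cderiv X (hInv H γ δ) z * pairing G F (s γ) (t δ) z +
      (traceForm H G F (fun γ => pullbackConn G F X (s γ)) t z +
        traceForm H G F s (fun δ => pullbackConn G F X (t δ)) z) := by
  have h1 (γ δ : Fin m) := (hH.contDiffOn_hInv γ δ).differentiableAt_of_isOpen hH.isOpen hz
  have h2 (γ δ : Fin m) :=
    (contDiffOn_pairing hG hF hFV (hs γ) (ht δ)).differentiableAt_of_isOpen hH.isOpen hz
  unfold traceForm
  rw [cderiv_sum fun γ _ => DifferentiableAt.fun_sum fun δ _ => (h1 γ δ).fun_mul (h2 γ δ)]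
  simp only [← Finset.sum_add_distrib]
  refine Finset.sum_congr rfl fun γ _ => ?_
  rw [cderiv_sum fun δ _ => (h1 γ δ).fun_mul (h2 γ δ)]
  refine Finset.sum_congr rfl fun δ _ => ?_
  rw [cderiv_mul (h1 γ δ) (h2 γ δ), cderiv_pairing hH.isOpen hG hF hFV (hs γ) (ht δ) hz]
  ring

/-- The derivative of `h^{γδ̄}` becomes, after exchanging `γ` with the summation index, the Chern
correction to `s`. The barred index of `t` gets none, because the Chern connection has `(0,1)` part
`∂̄`. -/
lemma delz_traceForm (hH : IsHermitianOn H U) (hG : IsMetricOn G V)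
    (hF : ContDiffOn ℝ ∞ F U) (hFV : Set.MapsTo F U V) {s t : Fin m → Fin n → CE m → ℂ}
    (hs : ∀ γ i, ContDiffOn ℝ ∞ (s γ i) U) (ht : ∀ γ i, ContDiffOn ℝ ∞ (t γ i) U)
    {z : CE m} (hz : z ∈ U) (α : Fin m) :
    cderiv (zvec α) (traceForm H G F s t) z =
      traceForm H G F (fun γ i w => pullbackConn G F (zvec α) (s γ) i w -
        ∑ κ, chernConn H κ α γ w * s κ i w) t z +
      traceForm H G F s (fun δ => pullbackConn G F (zvec α) (t δ)) z := by
  rw [cderiv_traceForm hH hG hF hFV hs ht hz, ← add_assoc]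
  congr 1
  simp only [traceForm, pairing_sub_sum_left, mul_sub, Finset.sum_sub_distrib, hH.delz_hInv hz,
    neg_mul, Finset.sum_neg_distrib]
  rw [neg_add_eq_sub]
  congr 1
  simp only [Finset.sum_mul, Finset.mul_sum]
  calc _ = ∑ γ, ∑ κ, ∑ δ, chernConn H γ α κ z * hInv H κ δ z * pairing G F (s γ) (t δ) z :=
        Finset.sum_congr rfl fun γ _ => Finset.sum_comm
    _ = ∑ κ, ∑ γ, ∑ δ, chernConn H γ α κ z * hInv H κ δ z * pairing G F (s γ) (t δ) z :=
        Finset.sum_comm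
    _ = ∑ κ, ∑ δ, ∑ γ, chernConn H γ α κ z * hInv H κ δ z * pairing G F (s γ) (t δ) z :=
        Finset.sum_congr rfl fun γ _ => Finset.sum_comm
    _ = _ := Finset.sum_congr rfl fun κ _ => Finset.sum_congr rfl fun δ _ =>
        Finset.sum_congr rfl fun γ _ => by ring

/-- Mirror image of `delz_traceForm`: now only the barred index carries a Chern correction. -/
lemma delzbar_traceForm (hH : IsHermitianOn H U) (hG : IsMetricOn G V)
    (hF : ContDiffOn ℝ ∞ F U) (hFV : Set.MapsTo F U V) {s t : Fin m → Fin n → CE m → ℂ}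
    (hs : ∀ γ i, ContDiffOn ℝ ∞ (s γ i) U) (ht : ∀ γ i, ContDiffOn ℝ ∞ (t γ i) U)
    {z : CE m} (hz : z ∈ U) (β : Fin m) :
    cderiv (zbarvec β) (traceForm H G F s t) z =
      traceForm H G F (fun γ => pullbackConn G F (zbarvec β) (s γ)) t z +
      traceForm H G F s (fun δ i w => pullbackConn G F (zbarvec β) (t δ) i w -
        ∑ κ, conj (chernConn H κ β δ w) * t κ i w) z := by
  rw [cderiv_traceForm hH hG hF hFV hs ht hz, add_left_comm]
  congr 1
  have hr (δ : Fin m) (γ : Fin m) := pairing_sub_sum_right G F (s γ)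
    (pullbackConn G F (zbarvec β) (t δ)) (fun κ w => conj (chernConn H κ β δ w)) t z
  simp only [traceForm, hr, mul_sub, Finset.sum_sub_distrib, hH.delzbar_hInv hz,
    neg_mul, Finset.sum_neg_distrib]
  rw [neg_add_eq_sub]
  congr 1
  simp only [Finset.sum_mul, Finset.mul_sum]
  refine Finset.sum_congr rfl fun γ _ => ?_
  rw [Finset.sum_comm]
  exact Finset.sum_congr rfl fun κ _ => Finset.sum_congr rfl fun δ _ => by ring

/-- `∂f` in components. -/
def delComp (F : CE m → RE n) (γ : Fin m) : Fin n → CE m → ℂ := fun i => delF F i γ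

/-- `∂̄f` in components. -/
def delbarComp (F : CE m → RE n) (γ : Fin m) : Fin n → CE m → ℂ := fun i => delbarF F i γ

lemma contDiffOn_delComp (hU : IsOpen U) (hF : ContDiffOn ℝ ∞ F U) (γ : Fin m) (i : Fin n) :
    ContDiffOn ℝ ∞ (delComp F γ i) U := by
  unfold delComp delF
  rw [delz_eq]
  exact (contDiffOn_coord hF i).cderiv hU _

lemma contDiffOn_delbarComp (hU : IsOpen U) (hF : ContDiffOn ℝ ∞ F U) (γ : Fin m) (i : Fin n) :
    ContDiffOn ℝ ∞ (delbarComp F γ i) U := by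
  unfold delbarComp delbarF
  rw [delzbar_eq]
  exact (contDiffOn_coord hF i).cderiv hU _

lemma conj_delComp (F : CE m → RE n) (γ : Fin m) (i : Fin n) (z : CE m) :
    conj (delComp F γ i z) = delbarComp F γ i z := by
  simp [delComp, delF, delbarComp, delbarF, delz_eq, delzbar_eq, conj_cderiv, zvec_conj]

lemma conj_delbarComp (F : CE m → RE n) (γ : Fin m) (i : Fin n) (z : CE m) :
    conj (delbarComp F γ i z) = delComp F γ i z := by
  rw [← conj_delComp, Complex.conj_conj]

/-- `u = |∂f|²` in coordinates. -/
def localEnergy (H : CE m → Matrix (Fin m) (Fin m) ℂ) (G : RE n → Matrix (Fin n) (Fin n) ℝ)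
    (F : CE m → RE n) : CE m → ℂ :=
  traceForm H G F (delComp F) (delbarComp F)

lemma contDiffOn_localEnergy (hH : IsHermitianOn H U) (hG : IsMetricOn G V)
    (hF : ContDiffOn ℝ ∞ F U) (hFV : Set.MapsTo F U V) :
    ContDiffOn ℝ ∞ (localEnergy H G F) U :=
  contDiffOn_traceForm hH hG hF hFV (contDiffOn_delComp hH.isOpen hF)
    (contDiffOn_delbarComp hH.isOpen hF)

lemma conj_localEnergy (hH : IsHermitianOn H U) (hG : IsMetricOn G V)
    (hFV : Set.MapsTo F U V) {z : CE m} (hz : z ∈ U) :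
    conj (localEnergy H G F z) = localEnergy H G F z := by
  simp only [localEnergy, traceForm, pairing, map_sum, map_mul, hH.conj_hInv hz, conj_delComp,
    conj_delbarComp, Complex.conj_ofReal]
  rw [Finset.sum_comm]
  refine Finset.sum_congr rfl fun γ _ => Finset.sum_congr rfl fun δ _ => ?_
  rw [Finset.sum_comm]
  congr 1
  refine Finset.sum_congr rfl fun i _ => Finset.sum_congr rfl fun j _ => ?_
  rw [hG.symm _ (hFV hz)]
  ring

/-- The pluriharmonic map equation in coordinates. -/
def IsPluriharmonicOn (G : RE n → Matrix (Fin n) (Fin n) ℝ) (F : CE m → RE n)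
    (U : Set (CE m)) : Prop :=
  ∀ z ∈ U, ∀ (α β : Fin m) (i : Fin n), pullbackConn G F (zvec α) (delbarComp F β) i z = 0

/-- As `F` is real, this is the conjugate of the pluriharmonic equation. -/
lemma IsPluriharmonicOn.pullbackConn_zbarvec (hph : IsPluriharmonicOn G F U) {z : CE m}
    (hz : z ∈ U) (α β : Fin m) (i : Fin n) :
    pullbackConn G F (zbarvec β) (delComp F α) i z = 0 := by
  have h := congrArg conj (hph z hz β α i)
  rw [conj_pullbackConn, zvec_conj, map_zero] at h
  simpa only [conj_delbarComp] using h

/-- The curvature operator `R(∂̄_β f, ∂̄_δ f)` annihilates `∂_α f`. -/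
lemma IsPluriharmonicOn.riemannQuad_eq_zero (hph : IsPluriharmonicOn G F U) (hU : IsOpen U)
    (hG : IsMetricOn G V) (hF : ContDiffOn ℝ ∞ F U) (hFV : Set.MapsTo F U V) {z : CE m}
    (hz : z ∈ U) (α β δ : Fin m) (d : Fin n → ℂ) :
    riemannQuad G (F z) (fun j => delbarComp F β j z) (fun j => delbarComp F δ j z)
      (fun j => delComp F α j z) d = 0 := by
  -- The inner derivative vanishes on the whole open set, so any further derivative of it is zero.
  -- The commutator of `∇_β̄` and `∇_δ̄` on `∂_α f` is then zero, and it equals the curvature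
  -- operator.
  have h0 (X : CE m × CE m) (β : Fin m) (i : Fin n) :
      pullbackConn G F X (pullbackConn G F (zbarvec β) (delComp F α)) i z = 0 := by
    rw [pullbackConn_congr hU (t := fun _ _ => 0)
      (fun i w hw => hph.pullbackConn_zbarvec hw α β i) X i hz]
    simp [pullbackConn]
  have h1 (i : Fin n) := pullbackConn_commutator hU hG hF hFV
    (contDiffOn_delComp hU hF α) hz (zbarvec β) (zbarvec δ) i
  simp only [h0, sub_zero, ← delzbar_eq] at h1
  have h2 := pairing_riemannUp G F z (delbarComp F β) (delbarComp F δ) (delComp F α)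
    (fun i _ => d i)
  rw [← h2]
  simp only [pairing]
  refine Finset.sum_eq_zero fun i _ => Finset.sum_eq_zero fun j _ => ?_
  simp only [delbarComp, delbarF] at h1 ⊢
  rw [← h1 i]
  simp

/-- The components of `∂_𝓕 ∂f`, with the form index first. -/
def nablaDelComp (H : CE m → Matrix (Fin m) (Fin m) ℂ) (G : RE n → Matrix (Fin n) (Fin n) ℝ)
    (F : CE m → RE n) (α γ : Fin m) : Fin n → CE m → ℂ :=
  fun i w => pullbackConn G F (zvec α) (delComp F γ) i w -
    ∑ κ, chernConn H κ α γ w * delComp F κ i w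

lemma nablaDelF_eq (H : CE m → Matrix (Fin m) (Fin m) ℂ) (G : RE n → Matrix (Fin n) (Fin n) ℝ)
    (F : CE m → RE n) (α γ : Fin m) (i : Fin n) (z : CE m) :
    nablaDelF H G F α i γ z = nablaDelComp H G F α γ i z := by
  simp only [nablaDelF, nablaF, nablaE_eq_pullbackConn]
  rfl

lemma contDiffOn_nablaDelComp (hH : IsHermitianOn H U) (hG : IsMetricOn G V)
    (hF : ContDiffOn ℝ ∞ F U) (hFV : Set.MapsTo F U V) (α γ : Fin m) (i : Fin n) :
    ContDiffOn ℝ ∞ (nablaDelComp H G F α γ i) U :=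
  (contDiffOn_pullbackConn hH.isOpen hG hF hFV _ (contDiffOn_delComp hH.isOpen hF γ) i).sub
    (ContDiffOn.sum fun κ _ => (hH.contDiffOn_chernConn κ α γ).mul
      (contDiffOn_delComp hH.isOpen hF κ i))

lemma conj_nablaDelComp (α γ : Fin m) (i : Fin n) (z : CE m) :
    conj (nablaDelComp H G F α γ i z) = pullbackConn G F (zbarvec α) (delbarComp F γ) i z -
      ∑ κ, conj (chernConn H κ α γ z) * delbarComp F κ i z := by
  simp only [nablaDelComp, map_sub, map_sum, map_mul, conj_pullbackConn, zvec_conj, conj_delComp]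

lemma traceForm_congr {s s' t t' : Fin m → Fin n → CE m → ℂ} {z : CE m}
    (hs : ∀ γ i, s γ i z = s' γ i z) (ht : ∀ γ i, t γ i z = t' γ i z) :
    traceForm H G F s t z = traceForm H G F s' t' z := by
  simp only [traceForm, pairing, hs, ht]

lemma gradTerm_eq_traceForm (α β : Fin m) (z : CE m) :
    gradTerm H G F α β z = traceForm H G F (nablaDelComp H G F α)
      (fun δ j w => conj (nablaDelComp H G F β δ j w)) z := by
  simp only [gradTerm, innerF, nablaDelF_eq, traceForm, pairing, Finset.mul_sum, mul_assoc]

/-- Contracting the index `δ` with `h^{μδ̄}` cancels the metric factor in `chernCurv`, leaving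
`-∂̄_β Γ^μ_{αγ}`. -/
lemma domainCurvTerm_eq_traceForm (hH : IsHermitianOn H U) {z : CE m} (hz : z ∈ U)
    (α β : Fin m) :
    domainCurvTerm H G F α β z = -traceForm H G F (fun γ i w =>
      ∑ κ, delzbar β (chernConn H κ α γ) w * delComp F κ i w) (delbarComp F) z := by
  have h1 (γ : Fin m) (μ : Fin m) : ∑ δ, chernCurv H α β γ δ z * hInv H μ δ z =
      -delzbar β (chernConn H μ α γ) z := by
    simp only [chernCurv, Finset.sum_mul]
    rw [Finset.sum_comm]
    calc _ = ∑ κ, -delzbar β (chernConn H κ α γ) z * ∑ δ, hInv H μ δ z * H z κ δ := by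
          simp only [Finset.mul_sum]
          exact Finset.sum_congr rfl fun κ _ => Finset.sum_congr rfl fun δ _ => by ring
      _ = _ := by simp [hH.sum_hInv_mul hz]
  have h2 : domainCurvTerm H G F α β z = ∑ γ, ∑ μ, ∑ ν,
      (∑ δ, chernCurv H α β γ δ z * hInv H μ δ z) * (hInv H γ ν z *
        pairing G F (delComp F μ) (delbarComp F ν) z) := by
    unfold domainCurvTerm
    refine Finset.sum_congr rfl fun γ _ => ?_
    rw [Finset.sum_comm]
    refine Finset.sum_congr rfl fun μ _ => ?_
    rw [Finset.sum_comm]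
    refine Finset.sum_congr rfl fun ν _ => ?_
    rw [Finset.sum_mul]
    refine Finset.sum_congr rfl fun δ _ => ?_
    simp only [pairing, Finset.mul_sum]
    exact Finset.sum_congr rfl fun i _ =>
      Finset.sum_congr rfl fun j _ => by simp only [delComp, delbarComp]; ring
  rw [h2]
  simp only [h1, traceForm, pairing_sum_left G F _ (fun κ w => delzbar β (chernConn H κ α _) w)
    (delComp F) z, ← Finset.sum_neg_distrib, Finset.mul_sum]
  refine Finset.sum_congr rfl fun γ _ => ?_
  rw [Finset.sum_comm]
  exact Finset.sum_congr rfl fun ν _ => Finset.sum_congr rfl fun μ _ => by ring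

lemma targetCurvTerm_eq_sum (H : CE m → Matrix (Fin m) (Fin m) ℂ)
    (G : RE n → Matrix (Fin n) (Fin n) ℝ) (F : CE m → RE n) (α β : Fin m) (z : CE m) :
    targetCurvTerm H G F α β z = ∑ γ, ∑ δ, hInv H γ δ z * riemannQuad G (F z)
      (fun j => delComp F α j z) (fun j => delbarComp F δ j z) (fun j => delComp F γ j z)
      (fun j => delbarComp F β j z) := by
  simp only [targetCurvTerm, riemannQuad, Finset.mul_sum]
  -- Fixing the two index types orients the exchange: only sums over `Fin m` move outward, so the
  -- rewriting terminates.
  simp only [Finset.sum_comm (s := (Finset.univ : Finset (Fin n)))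
    (t := (Finset.univ : Finset (Fin m)))]
  refine Finset.sum_congr rfl fun γ _ => Finset.sum_congr rfl fun δ _ =>
    Finset.sum_congr rfl fun i _ => Finset.sum_congr rfl fun l _ =>
    Finset.sum_congr rfl fun k _ => Finset.sum_congr rfl fun j _ => ?_
  simp only [delComp, delbarComp]
  ring

/-- The Chern-Lu identity in coordinates. -/
theorem IsPluriharmonicOn.hessian_localEnergy (hph : IsPluriharmonicOn G F U)
    (hH : IsHermitianOn H U) (hG : IsMetricOn G V) (hF : ContDiffOn ℝ ∞ F U)
    (hFV : Set.MapsTo F U V) {z : CE m} (hz : z ∈ U) (α β : Fin m) :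
    delz α (delzbar β (localEnergy H G F)) z =
      gradTerm H G F α β z + (domainCurvTerm H G F α β z - targetCurvTerm H G F α β z) := by
  have hU := hH.isOpen
  have hs := contDiffOn_delComp hU hF
  have ht := contDiffOn_delbarComp hU hF
  -- The `∂_α` derivative is taken first, since `∇_α` annihilates `∂̄f`.
  rw [delz_eq, delzbar_eq, cderiv_comm hU (contDiffOn_localEnergy hH hG hF hFV) hz]
  have h1 : ∀ w ∈ U, cderiv (zvec α) (localEnergy H G F) w =
      traceForm H G F (nablaDelComp H G F α) (delbarComp F) w := fun w hw => by
    rw [localEnergy, delz_traceForm hH hG hF hFV hs ht hw,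
      traceForm_congr (s' := delComp F) (t' := fun _ _ _ => 0) (fun _ _ => rfl)
        (fun δ i => hph w hw α δ i)]
    have : traceForm H G F (delComp F) (fun _ _ _ => 0) w = 0 := by simp [traceForm, pairing]
    rw [this, add_zero]
    rfl
  rw [cderiv_congr_of_isOpen hU h1 hz, delzbar_traceForm hH hG hF hFV
    (contDiffOn_nablaDelComp hH hG hF hFV α) ht hz, gradTerm_eq_traceForm,
    add_comm]
  congr 1
  · exact traceForm_congr (fun _ _ => rfl) fun δ j => (conj_nablaDelComp β δ j z).symm
  -- The other half of the Leibniz rule: `∇_β̄` applied to `∇_α ∂_γ f - Γ^κ_{αγ} ∂_κ f`. Since `∇_β̄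
  -- ∂f = 0`, the first part is a pure commutator and in the second only `Γ` is differentiated.
  have h2 (γ : Fin m) (i : Fin n) :
      pullbackConn G F (zbarvec β) (nablaDelComp H G F α γ) i z =
      (∑ k, (∑ j, ∑ l, (riemannUp G j l k i (F z) : ℂ) * delbarComp F β j z *
        delComp F α l z) * delComp F γ k z) -
      ∑ κ, delzbar β (chernConn H κ α γ) z * delComp F κ i z := by
    have hD (i : Fin n) := (contDiffOn_pullbackConn hU hG hF hFV (zvec α)
      (hs γ) i).differentiableAt_of_isOpen hU hz
    have hc (κ : Fin m) := (hH.contDiffOn_chernConn κ α γ).differentiableAt_of_isOpen hU hz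
    have hsd (κ : Fin m) (i : Fin n) := (hs κ i).differentiableAt_of_isOpen hU hz
    have e1 : pullbackConn G F (zbarvec β) (nablaDelComp H G F α γ) i z =
        pullbackConn G F (zbarvec β) (pullbackConn G F (zvec α) (delComp F γ)) i z -
        ∑ κ, (cderiv (zbarvec β) (chernConn H κ α γ) z * delComp F κ i z +
          chernConn H κ α γ z * pullbackConn G F (zbarvec β) (delComp F κ) i z) := by
      have e2 : cderiv (zbarvec β) (nablaDelComp H G F α γ i) z =
          cderiv (zbarvec β) (pullbackConn G F (zvec α) (delComp F γ) i) z -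
          ∑ κ, (cderiv (zbarvec β) (chernConn H κ α γ) z * delComp F κ i z +
            chernConn H κ α γ z * cderiv (zbarvec β) (delComp F κ i) z) := by
        unfold nablaDelComp
        rw [cderiv_sub (hD i) (DifferentiableAt.fun_sum fun κ _ => (hc κ).fun_mul (hsd κ i)),
          cderiv_sum fun κ _ => (hc κ).fun_mul (hsd κ i)]
        simp only [cderiv_mul (hc _) (hsd _ _)]
      have e3 : ∑ k, connForm G F (zbarvec β) i k z * nablaDelComp H G F α γ k z =
          ∑ k, connForm G F (zbarvec β) i k z * pullbackConn G F (zvec α) (delComp F γ) k z -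
          ∑ κ, chernConn H κ α γ z * ∑ k, connForm G F (zbarvec β) i k z * delComp F κ k z := by
        simp only [nablaDelComp, mul_sub, Finset.sum_sub_distrib, Finset.mul_sum]
        congr 1
        rw [Finset.sum_comm]
        exact Finset.sum_congr rfl fun κ _ => Finset.sum_congr rfl fun k _ => by ring
      rw [pullbackConn, e2, e3, pullbackConn]
      simp only [pullbackConn, mul_add, Finset.sum_add_distrib]
      ring
    have e4 : pullbackConn G F (zvec α) (pullbackConn G F (zbarvec β) (delComp F γ)) i z = 0 := by
      rw [pullbackConn_congr hU (t := fun _ _ => 0)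
        (fun i w hw => hph.pullbackConn_zbarvec hw γ β i) _ i hz]
      simp [pullbackConn]
    have e5 := pullbackConn_commutator hU hG hF hFV (hs γ) hz (zbarvec β) (zvec α) i
    rw [e4, sub_zero] at e5
    rw [e1, e5]
    simp only [hph.pullbackConn_zbarvec hz, mul_zero, add_zero, ← delzbar_eq, ← delz_eq]
    rfl
  -- Here `β` and `δ` trade places, the error term being zero by pluriharmonicity.
  have h3 (γ δ : Fin m) : riemannQuad G (F z) (fun j => delbarComp F β j z)
      (fun j => delComp F α j z) (fun j => delComp F γ j z) (fun j => delbarComp F δ j z) =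
      -riemannQuad G (F z) (fun j => delComp F α j z) (fun j => delbarComp F δ j z)
        (fun j => delComp F γ j z) (fun j => delbarComp F β j z) := by
    rw [riemannQuad_swap, riemannQuad_eq_add hG (hFV hz),
      hph.riemannQuad_eq_zero hU hG hF hFV hz, add_zero]
  rw [traceForm_congr (s' := fun γ i w =>
      (∑ k, (∑ j, ∑ l, (riemannUp G j l k i (F w) : ℂ) * delbarComp F β j w *
        delComp F α l w) * delComp F γ k w) -
      ∑ κ, delzbar β (chernConn H κ α γ) w * delComp F κ i w) (t' := delbarComp F) h2 (fun _ _ => rfl), domainCurvTerm_eq_traceForm hH hz,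
    targetCurvTerm_eq_sum]
  have h5 (γ δ : Fin m) := pairing_riemannUp G F z (delbarComp F β) (delComp F α) (delComp F γ)
    (delbarComp F δ)
  simp only [h3] at h5
  have h6 (γ δ : Fin m) : pairing G F (fun i w =>
      (∑ k, (∑ j, ∑ l, (riemannUp G j l k i (F w) : ℂ) * delbarComp F β j w *
        delComp F α l w) * delComp F γ k w) -
      ∑ κ, delzbar β (chernConn H κ α γ) w * delComp F κ i w) (delbarComp F δ) z =
      -riemannQuad G (F z) (fun j => delComp F α j z) (fun j => delbarComp F δ j z)
        (fun j => delComp F γ j z) (fun j => delbarComp F β j z) -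
      pairing G F (fun i w => ∑ κ, delzbar β (chernConn H κ α γ) w * delComp F κ i w)
        (delbarComp F δ) z := by
    rw [← h5, ← pairing_sub_left]
  simp only [traceForm, h6, mul_sub, Finset.sum_sub_distrib, mul_neg, Finset.sum_neg_distrib]
  ring

end LocalFormula

/-! ### Independence of the Hermitian trace from the basis. -/

section BaseChange

variable {m : ℕ} {V : Type*} [AddCommGroup V] [Module ℂ V]

lemma sesquilinear_matrix_basis_change (b b' : Module.Basis (Fin m) ℂ V)
    (B : V →ₗ[ℂ] V →ₗ⋆[ℂ] ℂ) :
    (Matrix.of fun α β => B (b' α) (b' β)) =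
      (b.toMatrix b').transpose * (Matrix.of fun α β => B (b α) (b β)) *
        (b.toMatrix b').map (starRingEnd ℂ) := by
  ext α β
  have h (α : Fin m) : b' α = ∑ κ, b.toMatrix b' κ α • b κ :=
    (b.sum_toMatrix_smul_self b' α).symm
  simp only [Matrix.of_apply]
  rw [h α, h β]
  simp only [map_sum, LinearMap.sum_apply, map_smul, LinearMap.smul_apply,
    LinearMap.map_smulₛₗ, smul_eq_mul, Matrix.mul_apply, Matrix.transpose_apply, Matrix.map_apply,
    Matrix.of_apply, Finset.sum_mul, Finset.mul_sum]
  exact Finset.sum_congr rfl fun κ _ => Finset.sum_congr rfl fun l _ => by ring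

/-- `L` cancels inside the product and `R` by cyclicity of the trace. In the application `L` is the
transpose and `R` the conjugate of the change-of-basis matrix. -/
lemma trace_inv_mul_basis_change {A C L R : Matrix (Fin m) (Fin m) ℂ} (hL : IsUnit L.det)
    (hR : IsUnit R.det) : ((L * A * R)⁻¹ * (L * C * R)).trace = (A⁻¹ * C).trace := by
  rw [Matrix.mul_inv_rev, Matrix.mul_inv_rev]
  calc (R⁻¹ * (A⁻¹ * L⁻¹) * (L * C * R)).trace = (R⁻¹ * (A⁻¹ * (L⁻¹ * L) * C * R)).trace := by
        simp only [Matrix.mul_assoc]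
    _ = (R * R⁻¹ * (A⁻¹ * C)).trace := by
        rw [Matrix.nonsing_inv_mul _ hL, Matrix.mul_one, Matrix.trace_mul_comm, Matrix.mul_assoc,
          Matrix.trace_mul_comm]
    _ = (A⁻¹ * C).trace := by rw [Matrix.mul_nonsing_inv _ hR, Matrix.one_mul]

/-- The trace of a sesquilinear form does not depend on the basis. -/
lemma hermTrace_eq (b b' : Module.Basis (Fin m) ℂ V) (h Q : V →ₗ[ℂ] V →ₗ⋆[ℂ] ℂ) :
    hermTrace b h (fun v w => Q v w) = hermTrace b' h (fun v w => Q v w) := by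
  have key (b : Module.Basis (Fin m) ℂ V) : hermTrace b h (fun v w => Q v w) =
      ((Matrix.of fun α β => h (b α) (b β))⁻¹ * Matrix.of fun α β => Q (b α) (b β)).trace := by
    simp only [hermTrace, Matrix.trace, Matrix.diag, Matrix.mul_apply, Matrix.of_apply]
    rw [Finset.sum_comm]
  have hPu : IsUnit (b.toMatrix b').det := by
    have := b.invertibleToMatrix b'
    exact Matrix.isUnit_det_of_invertible _
  have hPc : IsUnit ((b.toMatrix b').map (starRingEnd ℂ)).det := by
    rw [← RingHom.mapMatrix_apply, ← RingHom.map_det]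
    exact hPu.map _
  have hPt : IsUnit (b.toMatrix b').transpose.det := by rwa [Matrix.det_transpose]
  rw [key b, key b', sesquilinear_matrix_basis_change b b' h,
    sesquilinear_matrix_basis_change b b' Q, trace_inv_mul_basis_change hPt hPc]

end BaseChange

/-! ### Holomorphic charts as real charts, and metrics in charts. -/

section Manifold

variable {m n : ℕ} {M : Type*} [TopologicalSpace M] [ChartedSpace (CE m) M]
  {N : Type*} [TopologicalSpace N] [ChartedSpace (RE n) N]

/-- Complex analytic transition maps are real smooth, so holomorphic charts may serve as real charts
for the map `f`, which is smooth only in the real sense. -/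
lemma contDiffGroupoid_complex_le_real :
    contDiffGroupoid ω 𝓘(ℂ, CE m) ≤ contDiffGroupoid ∞ 𝓘(ℝ, CE m) := by
  apply groupoid_of_pregroupoid_le
  intro f s hfs
  have h : ContDiffOn ℂ ω f s := by simpa [contDiffPregroupoid] using hfs
  simpa [contDiffPregroupoid] using (h.restrict_scalars ℝ).of_le le_top

lemma mem_maximalAtlas_real {e : OpenPartialHomeomorph M (CE m)}
    (he : e ∈ IsManifold.maximalAtlas 𝓘(ℂ, CE m) ω M) :
    e ∈ IsManifold.maximalAtlas 𝓘(ℝ, CE m) ∞ M :=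
  StructureGroupoid.maximalAtlas_mono contDiffGroupoid_complex_le_real he

lemma mdifferentiable_of_mem_maximalAtlas {𝕜 : Type*} [NontriviallyNormedField 𝕜] {E : Type*}
    [NormedAddCommGroup E] [NormedSpace 𝕜 E] {M : Type*} [TopologicalSpace M] [ChartedSpace E M]
    {k : ℕ∞ω} [IsManifold 𝓘(𝕜, E) k M] (hk : 1 ≤ k) {e : OpenPartialHomeomorph M E}
    (he : e ∈ IsManifold.maximalAtlas 𝓘(𝕜, E) k M) : e.MDifferentiable 𝓘(𝕜, E) 𝓘(𝕜, E) :=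
  ⟨(contMDiffOn_of_mem_maximalAtlas he).mdifferentiableOn (by positivity),
    (contMDiffOn_symm_of_mem_maximalAtlas he).mdifferentiableOn (by positivity)⟩

/-- Both sides are Fréchet derivatives of one coordinate expression, and the real derivative is the
complex one with scalars restricted. -/
lemma mfderiv_real_eq_complex {e : OpenPartialHomeomorph M (CE m)} {z : CE m}
    (hC : MDifferentiableAt 𝓘(ℂ, CE m) 𝓘(ℂ, CE m) e.symm z)
    (hR : MDifferentiableAt 𝓘(ℝ, CE m) 𝓘(ℝ, CE m) e.symm z) (v : CE m) :
    (mfderiv 𝓘(ℝ, CE m) 𝓘(ℝ, CE m) e.symm z v : CE m) =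
      mfderiv 𝓘(ℂ, CE m) 𝓘(ℂ, CE m) e.symm z v := by
  have hd : DifferentiableAt ℂ (writtenInExtChartAt 𝓘(ℂ, CE m) 𝓘(ℂ, CE m) z e.symm) z := by
    have := hC.differentiableWithinAt_writtenInExtChartAt
    rw [modelWithCornersSelf_coe, Set.range_id, differentiableWithinAt_univ] at this
    exact this
  have hw : writtenInExtChartAt 𝓘(ℝ, CE m) 𝓘(ℝ, CE m) z e.symm =
      writtenInExtChartAt 𝓘(ℂ, CE m) 𝓘(ℂ, CE m) z e.symm := rfl
  rw [hC.mfderiv, hR.mfderiv]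
  simp only [modelWithCornersSelf_coe, Set.range_id, fderivWithin_univ, hw]
  change fderiv ℝ (writtenInExtChartAt 𝓘(ℂ, CE m) 𝓘(ℂ, CE m) z e.symm) z v =
    fderiv ℂ (writtenInExtChartAt 𝓘(ℂ, CE m) 𝓘(ℂ, CE m) z e.symm) z v
  rw [hd.fderiv_restrictScalars ℝ]
  rfl

lemma mfderiv_symm_eq_sum_coordVecN (ψ : OpenPartialHomeomorph N (RE n)) (y v : RE n) :
    mfderiv (𝓡 n) (𝓡 n) ψ.symm y v = ∑ i, v i • coordVecN ψ i y := by
  have h : v = ∑ i, v i • (EuclideanSpace.single i (1 : ℝ) : RE n) := by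
    conv_lhs => rw [← (EuclideanSpace.basisFun (Fin n) ℝ).sum_repr v]
    simp
  conv_lhs => rw [h]
  exact (map_sum (mfderiv (𝓡 n) (𝓡 n) ψ.symm y) _ _).trans
    (Finset.sum_congr rfl fun i _ => map_smul _ _ _)

lemma mfderiv_symm_eq_sum_coordVecM (e : OpenPartialHomeomorph M (CE m)) (z v : CE m) :
    mfderiv 𝓘(ℂ, CE m) 𝓘(ℂ, CE m) e.symm z v = ∑ i, v i • coordVecM e i z := by
  have h : v = ∑ i, v i • (EuclideanSpace.single i (1 : ℂ) : CE m) := by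
    conv_lhs => rw [← (EuclideanSpace.basisFun (Fin m) ℂ).sum_repr v]
    simp
  conv_lhs => rw [h]
  exact (map_sum (mfderiv 𝓘(ℂ, CE m) 𝓘(ℂ, CE m) e.symm z) _ _).trans
    (Finset.sum_congr rfl fun i _ => map_smul _ _ _)

lemma inner_mfderiv_symm [IsManifold (𝓡 n) ∞ N] (g : RiemMetric n N)
    (ψ : OpenPartialHomeomorph N (RE n)) (y v w : RE n) :
    g.inner (ψ.symm y) (mfderiv (𝓡 n) (𝓡 n) ψ.symm y v) (mfderiv (𝓡 n) (𝓡 n) ψ.symm y w) =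
      ∑ i, ∑ j, metricMatrix g ψ y i j * v i * w j := by
  rw [mfderiv_symm_eq_sum_coordVecN, mfderiv_symm_eq_sum_coordVecN]
  simp only [map_sum, sum_apply, map_smul, smul_apply, smul_eq_mul, metricMatrix, Matrix.of_apply,
    Finset.mul_sum]
  rw [Finset.sum_comm]
  exact Finset.sum_congr rfl fun i _ => Finset.sum_congr rfl fun j _ => by ring

lemma contDiffOn_metricMatrix [IsManifold (𝓡 n) ∞ N] (g : RiemMetric n N)
    {ψ : OpenPartialHomeomorph N (RE n)} (hψ : ψ ∈ IsManifold.maximalAtlas (𝓡 n) ∞ N)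
    (i j : Fin n) : ContDiffOn ℝ ∞ (fun y => metricMatrix g ψ y i j) ψ.target := by
  have hs : ContMDiffOn (𝓡 n) (𝓡 n) ∞ ψ.symm ψ.target := contMDiffOn_symm_of_mem_maximalAtlas hψ
  -- The coordinate field is the tangent map of `ψ.symm` applied to a constant section, hence
  -- smooth.
  have hv (i : Fin n) : ContMDiffOn (𝓡 n) ((𝓡 n).prod 𝓘(ℝ, RE n)) ∞
      (fun y => Bundle.TotalSpace.mk' (RE n) (E := fun q : N => TangentSpace (𝓡 n) q)
        (ψ.symm y) (coordVecN ψ i y)) ψ.target := by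
    have h1 := hs.contMDiffOn_tangentMapWithin (m := ∞) (by simp) ψ.open_target.uniqueMDiffOn
    have h2 : ContMDiff (𝓡 n) ((𝓡 n).prod 𝓘(ℝ, RE n)) ∞
        (fun y : RE n => Bundle.TotalSpace.mk' (RE n) (E := fun q : RE n => TangentSpace (𝓡 n) q)
          y (EuclideanSpace.single i (1 : ℝ) : RE n)) :=
      contMDiff_vectorSpace_iff_contDiff.2 contDiff_const
    refine (h1.comp h2.contMDiffOn fun y hy => hy).congr fun y hy => ?_
    simp only [Function.comp, tangentMapWithin, coordVecN]
    rw [mfderivWithin_of_isOpen ψ.open_target hy]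
  have hg : ContMDiffOn (𝓡 n) ((𝓡 n).prod 𝓘(ℝ, RE n →L[ℝ] RE n →L[ℝ] ℝ)) ∞
      (fun y => Bundle.TotalSpace.mk' (RE n →L[ℝ] RE n →L[ℝ] ℝ)
        (E := fun q : N => TangentSpace (𝓡 n) q →L[ℝ] TangentSpace (𝓡 n) q →L[ℝ] ℝ)
        (ψ.symm y) (g.inner (ψ.symm y))) ψ.target :=
    g.contMDiff.comp_contMDiffOn hs
  have : ContMDiffOn (𝓡 n) ((𝓡 n).prod 𝓘(ℝ)) ∞
      (fun y => Bundle.TotalSpace.mk' ℝ (E := Bundle.Trivial N ℝ) (ψ.symm y)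
        (g.inner (ψ.symm y) (coordVecN ψ i y) (coordVecN ψ j y))) ψ.target := by
    apply ContMDiffOn.clm_bundle_apply₂ (F₁ := RE n) (F₂ := RE n)
    · exact hg
    · exact hv i
    · exact hv j
  rw [← contMDiffOn_iff_contDiffOn]
  intro y hy
  have h2 := this y hy
  rw [Bundle.contMDiffWithinAt_totalSpace] at h2
  exact h2.2

lemma isMetricOn_metricMatrix [IsManifold (𝓡 n) ∞ N] (g : RiemMetric n N)
    {ψ : OpenPartialHomeomorph N (RE n)} (hψ : ψ ∈ IsManifold.maximalAtlas (𝓡 n) ∞ N) :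
    IsMetricOn (metricMatrix g ψ) ψ.target where
  isOpen := ψ.open_target
  smooth := contDiffOn_metricMatrix g hψ
  symm y _ i j := g.symm _ _ _
  isUnit_det y hy := by
    rw [isUnit_iff_ne_zero]
    intro h0
    -- A kernel vector would give a tangent vector of length zero; positivity and the injectivity of
    -- the derivative of the inverse chart force it to vanish.
    obtain ⟨v, hv, hv0⟩ := Matrix.exists_mulVec_eq_zero_iff.2 h0
    have h1 := inner_mfderiv_symm g ψ y (WithLp.toLp 2 v) (WithLp.toLp 2 v)
    have h2 : ∑ i, ∑ j, metricMatrix g ψ y i j * v i * v j = 0 := by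
      calc _ = ∑ i, v i * (metricMatrix g ψ y).mulVec v i := by
            simp only [Matrix.mulVec, dotProduct, Finset.mul_sum]
            exact Finset.sum_congr rfl fun i _ => Finset.sum_congr rfl fun j _ => by ring
        _ = 0 := by simp [hv0]
    have h3 : mfderiv (𝓡 n) (𝓡 n) ψ.symm y (WithLp.toLp 2 v : RE n) = 0 := by
      by_contra hne
      exact (g.pos _ _ hne).ne' (h1.trans h2)
    have hinj := (mdifferentiable_of_mem_maximalAtlas (by simp) hψ).symm.mfderiv_injective
      (x := y) hy
    have h4 : (WithLp.toLp 2 v : RE n) = 0 := hinj (h3.trans (map_zero _).symm)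
    exact hv (by simpa using congrArg WithLp.ofLp h4)

lemma form_mfderiv_symm [IsManifold 𝓘(ℂ, CE m) ω M] (h : HermitianMetric m M)
    (e : OpenPartialHomeomorph M (CE m)) (z v w : CE m) :
    h.form (e.symm z) (mfderiv 𝓘(ℂ, CE m) 𝓘(ℂ, CE m) e.symm z v)
      (mfderiv 𝓘(ℂ, CE m) 𝓘(ℂ, CE m) e.symm z w) =
      ∑ i, ∑ j, h.matrix e z i j * v i * conj (w j) := by
  rw [mfderiv_symm_eq_sum_coordVecM, mfderiv_symm_eq_sum_coordVecM]
  simp only [map_sum, LinearMap.sum_apply, map_smul, LinearMap.smul_apply, LinearMap.map_smulₛₗ,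
    smul_eq_mul, HermitianMetric.matrix, Matrix.of_apply, Finset.mul_sum]
  rw [Finset.sum_comm]
  exact Finset.sum_congr rfl fun κ _ => Finset.sum_congr rfl fun l _ => by ring

lemma isHermitianOn_matrix [IsManifold 𝓘(ℂ, CE m) ω M] (h : HermitianMetric m M)
    {e : OpenPartialHomeomorph M (CE m)} (he : e ∈ IsManifold.maximalAtlas 𝓘(ℂ, CE m) ω M) :
    IsHermitianOn (h.matrix e) e.target where
  isOpen := e.open_target
  smooth := h.smooth e he
  conj_symm z _ α β := h.symm _ _ _
  isUnit_det z hz := by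
    rw [isUnit_iff_ne_zero]
    intro h0
    -- The left kernel is used because `v` enters unconjugated through the first slot of the form.
    obtain ⟨v, hv, hv0⟩ := Matrix.exists_vecMul_eq_zero_iff.2 h0
    have h1 := form_mfderiv_symm h e z (WithLp.toLp 2 v) (WithLp.toLp 2 v)
    have h2 : ∑ i, ∑ j, h.matrix e z i j * v i * conj (v j) = 0 := by
      calc _ = ∑ j, Matrix.vecMul v (h.matrix e z) j * conj (v j) := by
            simp only [Matrix.vecMul, dotProduct, Finset.sum_mul]
            rw [Finset.sum_comm]
            exact Finset.sum_congr rfl fun i _ => Finset.sum_congr rfl fun j _ => by ring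
        _ = 0 := by simp [hv0]
    have h3 : mfderiv 𝓘(ℂ, CE m) 𝓘(ℂ, CE m) e.symm z (WithLp.toLp 2 v : CE m) = 0 := by
      by_contra hne
      have h4 := h.pos _ _ hne
      rw [h1.trans h2] at h4
      simp at h4
    have hinj := (mdifferentiable_of_mem_maximalAtlas (by simp) he).symm.mfderiv_injective
      (x := z) hz
    have h4 : (WithLp.toLp 2 v : CE m) = 0 := hinj (h3.trans (map_zero _).symm)
    exact hv (by simpa using congrArg WithLp.ofLp h4)

end Manifold

/-! ### From coordinates to the manifold. -/

section LocalEnergy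

variable {m n : ℕ} {M : Type*} [TopologicalSpace M] {N : Type*} [TopologicalSpace N]
  {e : OpenPartialHomeomorph M (CE m)} {ψ : OpenPartialHomeomorph N (RE n)} {f : M → N}

/-- The domain of the coordinate expression of `f`. -/
def localDomain (e : OpenPartialHomeomorph M (CE m)) (ψ : OpenPartialHomeomorph N (RE n))
    (f : M → N) : Set (CE m) :=
  e.target ∩ e.symm ⁻¹' (f ⁻¹' ψ.source)

lemma isOpen_localDomain (hf : Continuous f) : IsOpen (localDomain e ψ f) :=
  e.symm.isOpen_inter_preimage (ψ.open_source.preimage hf)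

lemma mem_localDomain {p : M} (hp : p ∈ e.source) (hfp : f p ∈ ψ.source) :
    e p ∈ localDomain e ψ f :=
  ⟨e.map_source hp, by simpa [e.left_inv hp] using hfp⟩

lemma mapsTo_localRep : Set.MapsTo (localRep e ψ f) (localDomain e ψ f) ψ.target :=
  fun _ hz => ψ.map_source hz.2

variable [ChartedSpace (CE m) M]

lemma isHermitianOn_localDomain [IsManifold 𝓘(ℂ, CE m) ω M]
    (he : e ∈ IsManifold.maximalAtlas 𝓘(ℂ, CE m) ω M) (h : HermitianMetric m M)
    (ψ : OpenPartialHomeomorph N (RE n)) (hf : Continuous f) :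
    IsHermitianOn (h.matrix e) (localDomain e ψ f) :=
  have hh := isHermitianOn_matrix h he
  { isOpen := isOpen_localDomain hf
    smooth := fun α β => (hh.smooth α β).mono Set.inter_subset_left
    conj_symm := fun z hz => hh.conj_symm z hz.1
    isUnit_det := fun z hz => hh.isUnit_det z hz.1 }

variable [ChartedSpace (RE n) N]

lemma contDiffOn_localRep [IsManifold 𝓘(ℂ, CE m) ω M] [IsManifold (𝓡 n) ∞ N]
    (he : e ∈ IsManifold.maximalAtlas 𝓘(ℂ, CE m) ω M)
    (hψ : ψ ∈ IsManifold.maximalAtlas (𝓡 n) ∞ N) (hf : ContMDiff 𝓘(ℝ, CE m) (𝓡 n) ∞ f) :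
    ContDiffOn ℝ ∞ (localRep e ψ f) (localDomain e ψ f) := by
  rw [← contMDiffOn_iff_contDiffOn]
  have h1 : ContMDiffOn 𝓘(ℝ, CE m) 𝓘(ℝ, CE m) ∞ e.symm e.target :=
    contMDiffOn_symm_of_mem_maximalAtlas (mem_maximalAtlas_real he)
  have h2 : ContMDiffOn (𝓡 n) (𝓡 n) ∞ ψ ψ.source := contMDiffOn_of_mem_maximalAtlas hψ
  exact h2.comp ((hf.comp_contMDiffOn h1).mono Set.inter_subset_left) fun z hz => hz.2

/-- Chain rule on both sides of `f ∘ e.symm = ψ.symm ∘ localRep e ψ f`, which holds near `z`. -/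
lemma realDiff_mfderiv_symm [IsManifold 𝓘(ℂ, CE m) ω M] [IsManifold (𝓡 n) ∞ N]
    (he : e ∈ IsManifold.maximalAtlas 𝓘(ℂ, CE m) ω M)
    (hψ : ψ ∈ IsManifold.maximalAtlas (𝓡 n) ∞ N) (hf : ContMDiff 𝓘(ℝ, CE m) (𝓡 n) ∞ f)
    {z : CE m} (hz : z ∈ localDomain e ψ f) (a : CE m) :
    (realDiff f (e.symm z) (mfderiv 𝓘(ℂ, CE m) 𝓘(ℂ, CE m) e.symm z a) : RE n) =
      mfderiv (𝓡 n) (𝓡 n) ψ.symm (localRep e ψ f z) (fderiv ℝ (localRep e ψ f) z a) := by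
  have hU := isOpen_localDomain (e := e) (ψ := ψ) hf.continuous
  have hC : MDifferentiableAt 𝓘(ℂ, CE m) 𝓘(ℂ, CE m) e.symm z :=
    (mdifferentiable_of_mem_maximalAtlas (by simp) he).mdifferentiableAt_symm hz.1
  have hR : MDifferentiableAt 𝓘(ℝ, CE m) 𝓘(ℝ, CE m) e.symm z :=
    (contMDiffAt_symm_of_mem_maximalAtlas (mem_maximalAtlas_real he) hz.1).mdifferentiableAt
      (by simp)
  have hψd : MDifferentiableAt (𝓡 n) (𝓡 n) ψ.symm (localRep e ψ f z) :=
    (mdifferentiable_of_mem_maximalAtlas (by simp) hψ).mdifferentiableAt_symm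
      (mapsTo_localRep hz)
  have hfd : MDifferentiableAt 𝓘(ℝ, CE m) (𝓡 n) f (e.symm z) :=
    hf.mdifferentiable (by simp) _
  have hFd : DifferentiableAt ℝ (localRep e ψ f) z :=
    (contDiffOn_localRep he hψ hf).differentiableAt_of_isOpen hU hz
  have h1 : mfderiv 𝓘(ℝ, CE m) (𝓡 n) (f ∘ e.symm) z =
      (mfderiv 𝓘(ℝ, CE m) (𝓡 n) f (e.symm z)).comp
        (mfderiv 𝓘(ℝ, CE m) 𝓘(ℝ, CE m) e.symm z) := mfderiv_comp z hfd hR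
  have h2 : mfderiv 𝓘(ℝ, CE m) (𝓡 n) (ψ.symm ∘ localRep e ψ f) z =
      (mfderiv (𝓡 n) (𝓡 n) ψ.symm (localRep e ψ f z)).comp
        (mfderiv 𝓘(ℝ, CE m) (𝓡 n) (localRep e ψ f) z) :=
    mfderiv_comp z hψd hFd.mdifferentiableAt
  have h3 : f ∘ e.symm =ᶠ[nhds z] ψ.symm ∘ localRep e ψ f :=
    Filter.eventuallyEq_of_mem (hU.mem_nhds hz) fun w hw => (ψ.left_inv hw.2).symm
  have h4 := h3.mfderiv_eq (I := 𝓘(ℝ, CE m)) (I' := 𝓡 n)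
  have h5 : (mfderiv 𝓘(ℝ, CE m) (𝓡 n) (f ∘ e.symm) z a : RE n) =
      mfderiv 𝓘(ℝ, CE m) (𝓡 n) (ψ.symm ∘ localRep e ψ f) z a := by
    rw [h4]
    rfl
  rw [h1, h2, mfderiv_eq_fderiv] at h5
  refine Eq.trans ?_ h5
  change (mfderiv 𝓘(ℝ, CE m) (𝓡 n) f (e.symm z) _ : RE n) =
    mfderiv 𝓘(ℝ, CE m) (𝓡 n) f (e.symm z) (mfderiv 𝓘(ℝ, CE m) 𝓘(ℝ, CE m) e.symm z a)
  rw [mfderiv_real_eq_complex hC hR]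

lemma fderiv_localRep_apply [IsManifold 𝓘(ℂ, CE m) ω M] [IsManifold (𝓡 n) ∞ N]
    (he : e ∈ IsManifold.maximalAtlas 𝓘(ℂ, CE m) ω M)
    (hψ : ψ ∈ IsManifold.maximalAtlas (𝓡 n) ∞ N) (hf : ContMDiff 𝓘(ℝ, CE m) (𝓡 n) ∞ f)
    {z : CE m} (hz : z ∈ localDomain e ψ f) (γ : Fin m) (i : Fin n) :
    delComp (localRep e ψ f) γ i z =
      (fderiv ℝ (localRep e ψ f) z ((1 / 2 : ℝ) • EuclideanSpace.single γ (1 : ℂ)) i : ℂ) +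
      Complex.I * (fderiv ℝ (localRep e ψ f) z
        (-((1 / 2 : ℝ) • EuclideanSpace.single γ Complex.I)) i : ℂ) := by
  have hFd : DifferentiableAt ℝ (localRep e ψ f) z :=
    (contDiffOn_localRep he hψ hf).differentiableAt_of_isOpen (isOpen_localDomain hf.continuous) hz
  have h3 : DifferentiableAt ℝ (fun w => localRep e ψ f w i) z := differentiableAt_euclidean.1 hFd i
  have h4 : fderiv ℝ (fun w => localRep e ψ f w i) z =
      (EuclideanSpace.proj i : RE n →L[ℝ] ℝ).comp (fderiv ℝ (localRep e ψ f) z) :=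
    ((EuclideanSpace.proj i : RE n →L[ℝ] ℝ).hasFDerivAt.comp z hFd.hasFDerivAt).fderiv
  unfold delComp delF
  rw [delz_eq, cderiv, fderiv_ofReal_comp h3, fderiv_ofReal_comp h3, h4]
  rfl

lemma gHerm_mfderiv_symm [IsManifold (𝓡 n) ∞ N] (g : RiemMetric n N)
    (ψ : OpenPartialHomeomorph N (RE n)) (y a b c d : RE n) :
    gHerm g (ψ.symm y) (mfderiv (𝓡 n) (𝓡 n) ψ.symm y a) (mfderiv (𝓡 n) (𝓡 n) ψ.symm y b)
      (mfderiv (𝓡 n) (𝓡 n) ψ.symm y c) (mfderiv (𝓡 n) (𝓡 n) ψ.symm y d) =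
      ∑ i, ∑ j, (metricMatrix g ψ y i j : ℂ) * ((a i : ℂ) + Complex.I * (b i : ℂ)) *
        conj ((c j : ℂ) + Complex.I * (d j : ℂ)) := by
  simp only [gHerm, inner_mfderiv_symm, ← Finset.sum_add_distrib, ← Finset.sum_sub_distrib,
    Complex.ofReal_sum, Finset.mul_sum]
  refine Finset.sum_congr rfl fun i _ => Finset.sum_congr rfl fun j _ => ?_
  simp only [map_add, map_mul, Complex.conj_ofReal, Complex.conj_I]
  push_cast
  linear_combination ((metricMatrix g ψ y i j : ℂ) * b i * d j) * Complex.I_mul_I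

lemma gHerm_congr [IsManifold (𝓡 n) ∞ N] (g : RiemMetric n N) {q q' : N} (h : q = q')
    (a b c d : RE n) : gHerm g q a b c d = gHerm g q' a b c d := by
  subst h
  rfl

/-- The real and imaginary parts of `∂f(∂/∂z^γ)` are the derivatives of `f` along the two components
of `zvec γ`; expanding them in the frame `∂/∂y^i` gives the coefficients `f^i_γ`. -/
lemma delPairing_eq_pairing [IsManifold 𝓘(ℂ, CE m) ω M] [IsManifold (𝓡 n) ∞ N]
    (he : e ∈ IsManifold.maximalAtlas 𝓘(ℂ, CE m) ω M)
    (hψ : ψ ∈ IsManifold.maximalAtlas (𝓡 n) ∞ N) (g : RiemMetric n N)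
    (hf : ContMDiff 𝓘(ℝ, CE m) (𝓡 n) ∞ f) {z : CE m} (hz : z ∈ localDomain e ψ f)
    (γ δ : Fin m) :
    delPairing g f (e.symm z) (coordVecM e γ z) (coordVecM e δ z) =
      pairing (metricMatrix g ψ) (localRep e ψ f) (delComp (localRep e ψ f) γ)
        (delbarComp (localRep e ψ f) δ) z := by
  have h1 (γ : Fin m) : ((1 / 2 : ℝ) • realDiff f (e.symm z) (coordVecM e γ z) : RE n) =
      mfderiv (𝓡 n) (𝓡 n) ψ.symm (localRep e ψ f z) (fderiv ℝ (localRep e ψ f) z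
        ((1 / 2 : ℝ) • EuclideanSpace.single γ (1 : ℂ))) := by
    have h := realDiff_mfderiv_symm he hψ hf hz (EuclideanSpace.single γ (1 : ℂ))
    rw [map_smul]
    refine Eq.trans ?_ (map_smul (mfderiv (𝓡 n) (𝓡 n) ψ.symm (localRep e ψ f z)) _ _).symm
    exact congrArg (fun v : RE n => (1 / 2 : ℝ) • v) h
  have h2 (γ : Fin m) :
      (-((1 / 2 : ℝ) • realDiff f (e.symm z) (Complex.I • coordVecM e γ z)) : RE n) =
      mfderiv (𝓡 n) (𝓡 n) ψ.symm (localRep e ψ f z) (fderiv ℝ (localRep e ψ f) z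
        (-((1 / 2 : ℝ) • EuclideanSpace.single γ Complex.I))) := by
    have h := realDiff_mfderiv_symm he hψ hf hz (EuclideanSpace.single γ Complex.I)
    have h0 : mfderiv 𝓘(ℂ, CE m) 𝓘(ℂ, CE m) e.symm z (EuclideanSpace.single γ Complex.I : CE m) =
        Complex.I • coordVecM e γ z := by
      have : (EuclideanSpace.single γ Complex.I : CE m) =
          Complex.I • EuclideanSpace.single γ (1 : ℂ) := by
        ext j
        simp
      rw [this]
      exact map_smul _ _ _
    rw [h0] at h
    rw [map_neg, map_smul]
    refine Eq.trans ?_ (map_neg (mfderiv (𝓡 n) (𝓡 n) ψ.symm (localRep e ψ f z)) _).symm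
    refine Eq.trans ?_ (congrArg (fun v : RE n => -v)
      (map_smul (mfderiv (𝓡 n) (𝓡 n) ψ.symm (localRep e ψ f z)) _ _).symm)
    exact congrArg (fun v : RE n => -((1 / 2 : ℝ) • v)) h
  -- The two base points agree only propositionally, so the vectors are viewed in `RE n` and moved
  -- by `gHerm_congr`.
  have h3 : f (e.symm z) = ψ.symm (localRep e ψ f z) := (ψ.left_inv hz.2).symm
  calc delPairing g f (e.symm z) (coordVecM e γ z) (coordVecM e δ z)
      = gHerm g (ψ.symm (localRep e ψ f z))
        ((1 / 2 : ℝ) • realDiff f (e.symm z) (coordVecM e γ z) : RE n)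
        (-((1 / 2 : ℝ) • realDiff f (e.symm z) (Complex.I • coordVecM e γ z)) : RE n)
        ((1 / 2 : ℝ) • realDiff f (e.symm z) (coordVecM e δ z) : RE n)
        (-((1 / 2 : ℝ) • realDiff f (e.symm z) (Complex.I • coordVecM e δ z)) : RE n) :=
        gHerm_congr g h3 _ _ _ _
    _ = _ := by
        rw [h1, h2, h1, h2, gHerm_mfderiv_symm]
        simp only [pairing, ← conj_delComp, fderiv_localRep_apply he hψ hf hz]

/-- `⟨∂f(v), ∂f(w)⟩` as a sesquilinear form. -/
def delPairingForm [IsManifold (𝓡 n) ∞ N] (g : RiemMetric n N) (f : M → N) (p : M) :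
    TangentSpace 𝓘(ℂ, CE m) p →ₗ[ℂ] TangentSpace 𝓘(ℂ, CE m) p →ₗ⋆[ℂ] ℂ := by
  have hadd (v w : TangentSpace 𝓘(ℂ, CE m) p) :
      realDiff f p (v + w) = realDiff (n := n) f p v + realDiff f p w :=
    map_add (mfderiv 𝓘(ℝ, CE m) (𝓡 n) f p) _ _
  have hsmul (c : ℝ) (v : TangentSpace 𝓘(ℂ, CE m) p) :
      realDiff f p ((c : ℂ) • v) = c • realDiff (n := n) f p v := by
    have h : ((c : ℂ) • v : CE m) = c • (v : CE m) := Complex.coe_smul c (v : CE m)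
    exact (congrArg (mfderiv 𝓘(ℝ, CE m) (𝓡 n) f p) h).trans
      (map_smul (mfderiv 𝓘(ℝ, CE m) (𝓡 n) f p) c _)
  have hc (c : ℂ) (v : TangentSpace 𝓘(ℂ, CE m) p) : realDiff f p (c • v) =
      c.re • realDiff (n := n) f p v + c.im • realDiff f p (Complex.I • v) := by
    rw [← hsmul, ← hsmul, ← hadd, smul_smul, ← add_smul, Complex.re_add_im]
  have hI (c : ℂ) (v : TangentSpace 𝓘(ℂ, CE m) p) : realDiff f p (Complex.I • c • v) =
      c.re • realDiff f p (Complex.I • v) - c.im • realDiff (n := n) f p v := by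
    rw [smul_smul, hc]
    simp [sub_eq_add_neg, add_comm]
  refine LinearMap.mk₂'ₛₗ (RingHom.id ℂ) (starRingEnd ℂ) (delPairing g f p) ?_ ?_ ?_ ?_
  · intro v v' w
    simp only [delPairing, gHerm, hadd, smul_add, map_add, map_neg, add_apply, neg_apply,
      neg_add]
    push_cast
    ring
  · intro c v w
    conv_rhs => rw [RingHom.id_apply, ← Complex.re_add_im c]
    simp only [delPairing, gHerm, hc c, hI c, smul_eq_mul, smul_add, smul_sub, map_add, map_sub,
      map_neg, map_smul, add_apply, neg_apply, sub_apply, smul_apply]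
    push_cast
    ring_nf
    simp only [Complex.I_sq]
    ring
  · intro v w w'
    simp only [delPairing, gHerm, hadd, smul_add, map_add, map_neg, neg_apply, neg_add]
    push_cast
    ring
  · intro c v w
    conv_rhs => rw [← Complex.re_add_im c]
    simp only [delPairing, gHerm, hc c, hI c, smul_eq_mul, smul_add, smul_sub, map_add, map_sub,
      map_neg, map_smul, neg_apply, smul_apply, map_mul, Complex.conj_ofReal,
      Complex.conj_I]
    push_cast
    ring_nf
    simp only [Complex.I_sq]
    ring

/-- `energy` uses the standard basis of the model space. The trace is unchanged in the basis `b'`,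
the image of that basis under the derivative of `e.symm`, which is the frame `∂/∂z^γ`. -/
lemma energy_eq_localEnergy [IsManifold 𝓘(ℂ, CE m) ω M] [IsManifold (𝓡 n) ∞ N]
    (he : e ∈ IsManifold.maximalAtlas 𝓘(ℂ, CE m) ω M)
    (hψ : ψ ∈ IsManifold.maximalAtlas (𝓡 n) ∞ N) (h : HermitianMetric m M) (g : RiemMetric n N)
    (hf : ContMDiff 𝓘(ℝ, CE m) (𝓡 n) ∞ f) {z : CE m} (hz : z ∈ localDomain e ψ f) :
    energy h g f (e.symm z) =
      (localEnergy (h.matrix e) (metricMatrix g ψ) (localRep e ψ f) z).re := by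
  let L := ((mdifferentiable_of_mem_maximalAtlas (by simp) he).symm.mfderiv
    (x := z) hz.1).toLinearEquiv
  let b₀ : Module.Basis (Fin m) ℂ (TangentSpace 𝓘(ℂ, CE m) z) :=
    (EuclideanSpace.basisFun (Fin m) ℂ).toBasis
  let b' : Module.Basis (Fin m) ℂ (TangentSpace 𝓘(ℂ, CE m) (e.symm z)) := b₀.map L
  have hb' (γ : Fin m) : b' γ = coordVecM e γ z := by
    have h0 : b₀ γ = (EuclideanSpace.single γ (1 : ℂ) : CE m) := by
      change (EuclideanSpace.basisFun (Fin m) ℂ).toBasis γ = _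
      simp
    rw [Module.Basis.map_apply, h0]
    rfl
  have h1 : hermTrace (V := TangentSpace 𝓘(ℂ, CE m) (e.symm z))
      (EuclideanSpace.basisFun (Fin m) ℂ).toBasis (h.form (e.symm z))
      (delPairing g f (e.symm z)) =
      hermTrace b' (h.form (e.symm z)) (delPairing g f (e.symm z)) :=
    hermTrace_eq _ b' (h.form (e.symm z)) (delPairingForm g f (e.symm z))
  rw [energy]
  congr 1
  refine h1.trans ?_
  simp only [hermTrace, hb', delPairing_eq_pairing he hψ g hf hz]
  rfl

/-- The energy density of a smooth map is smooth. -/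
lemma contMDiff_energy [IsManifold 𝓘(ℂ, CE m) ω M] [IsManifold (𝓡 n) ∞ N]
    (h : HermitianMetric m M) (g : RiemMetric n N) (hf : ContMDiff 𝓘(ℝ, CE m) (𝓡 n) ∞ f) :
    ContMDiff 𝓘(ℝ, CE m) 𝓘(ℝ, ℝ) ∞ (energy h g f) := by
  intro p
  let e := chartAt (CE m) p
  let ψ := chartAt (RE n) (f p)
  have he : e ∈ IsManifold.maximalAtlas 𝓘(ℂ, CE m) ω M := IsManifold.chart_mem_maximalAtlas p
  have hψ : ψ ∈ IsManifold.maximalAtlas (𝓡 n) ∞ N := IsManifold.chart_mem_maximalAtlas (f p)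
  have hp : p ∈ e.source := mem_chart_source _ p
  have hfp : f p ∈ ψ.source := mem_chart_source _ (f p)
  have hU := isOpen_localDomain (e := e) (ψ := ψ) hf.continuous
  have h1 := contDiffOn_localEnergy (isHermitianOn_localDomain he h ψ hf.continuous)
    (isMetricOn_metricMatrix g hψ) (contDiffOn_localRep he hψ hf) mapsTo_localRep
  have h2 := (Complex.reCLM.contDiff.comp_contDiffOn h1).contDiffAt
    (hU.mem_nhds (mem_localDomain hp hfp))
  have he' : ContMDiffAt 𝓘(ℝ, CE m) 𝓘(ℝ, CE m) ∞ e p :=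
    contMDiffAt_of_mem_maximalAtlas (mem_maximalAtlas_real he) hp
  refine (h2.contMDiffAt.comp p he').congr_of_eventuallyEq ?_
  have hnhds : e.source ∩ e ⁻¹' localDomain e ψ f ∈ nhds p :=
    (e.isOpen_inter_preimage hU).mem_nhds ⟨hp, mem_localDomain hp hfp⟩
  refine Filter.eventuallyEq_of_mem hnhds fun q hq => ?_
  have h3 := energy_eq_localEnergy he hψ h g hf hq.2
  rw [e.left_inv hq.1] at h3
  exact h3

/-- The Chern-Lu identity for the components of the complex Hessian of the energy density. -/
lemma complexHessian_energy [IsManifold 𝓘(ℂ, CE m) ω M] [IsManifold (𝓡 n) ∞ N]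
    (h : HermitianMetric m M) (g : RiemMetric n N) (hf : ContMDiff 𝓘(ℝ, CE m) (𝓡 n) ∞ f)
    (hph : IsPluriharmonic (m := m) (n := n) g f) (he : e ∈ IsManifold.maximalAtlas 𝓘(ℂ, CE m) ω M)
    (hψ : ψ ∈ IsManifold.maximalAtlas (𝓡 n) ∞ N) {p : M} (hp : p ∈ e.source)
    (hfp : f p ∈ ψ.source) (α β : Fin m) :
    complexHessian e (energy h g f) α β (e p) =
      gradTerm (h.matrix e) (metricMatrix g ψ) (localRep e ψ f) α β (e p) +
      (domainCurvTerm (h.matrix e) (metricMatrix g ψ) (localRep e ψ f) α β (e p) -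
        targetCurvTerm (h.matrix e) (metricMatrix g ψ) (localRep e ψ f) α β (e p)) := by
  have hU := isOpen_localDomain (e := e) (ψ := ψ) hf.continuous
  have hH := isHermitianOn_localDomain he h ψ hf.continuous
  have hG := isMetricOn_metricMatrix g hψ
  have hpl : IsPluriharmonicOn (metricMatrix g ψ) (localRep e ψ f) (localDomain e ψ f) := by
    intro z hz α β i
    have h1 := hph e he ψ hψ (e.symm z) (e.map_target hz.1) hz.2 α β i
    rwa [e.right_inv hz.1, nablaE_eq_pullbackConn] at h1
  have h1 : ∀ z ∈ localDomain e ψ f, ((energy h g f (e.symm z) : ℝ) : ℂ) =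
      localEnergy (h.matrix e) (metricMatrix g ψ) (localRep e ψ f) z := fun z hz => by
    rw [energy_eq_localEnergy he hψ h g hf hz]
    -- `localEnergy` is complex valued but equals its conjugate, so taking the real part in `energy`
    -- loses nothing.
    exact Complex.conj_eq_iff_re.1 (conj_localEnergy hH hG mapsTo_localRep hz)
  rw [← hpl.hessian_localEnergy hH hG (contDiffOn_localRep he hψ hf) mapsTo_localRep
    (mem_localDomain hp hfp)]
  simp only [complexHessian, delz_eq, delzbar_eq]
  -- Two derivatives are compared, so the equality of functions is used on the whole open domain at
  -- both levels.
  exact cderiv_congr_of_isOpen hU (fun z hz => cderiv_congr_of_isOpen hU h1 hz)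
    (mem_localDomain hp hfp)

end LocalEnergy

end ChernLu

end

theorem proposition1p7 {m n : ℕ}
    {M : Type*} [TopologicalSpace M] [ChartedSpace (ChernLu.CE m) M]
    [IsManifold 𝓘(ℂ, ChernLu.CE m) ω M]
    {N : Type*} [TopologicalSpace N] [ChartedSpace (ChernLu.RE n) N] [IsManifold (𝓡 n) ∞ N]
    (h : ChernLu.HermitianMetric m M) (g : ChernLu.RiemMetric n N)
    (f : M → N) (hf : ContMDiff 𝓘(ℝ, ChernLu.CE m) (𝓡 n) ∞ f)
    (hph : ChernLu.IsPluriharmonic (m := m) (n := n) g f) :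
    ContMDiff 𝓘(ℝ, ChernLu.CE m) 𝓘(ℝ, ℝ) ∞ (ChernLu.energy h g f) ∧
    ∀ e ∈ IsManifold.maximalAtlas 𝓘(ℂ, ChernLu.CE m) ω M,
    ∀ ψ ∈ IsManifold.maximalAtlas (𝓡 n) ∞ N,
    ∀ p ∈ e.source, f p ∈ ψ.source →
      (∀ v w : TangentSpace 𝓘(ℂ, ChernLu.CE m) p,
        ChernLu.ddbar e (ChernLu.energy h g f) p v w =
          ChernLu.form11 e p (fun α β => ChernLu.gradTerm (h.matrix e)
            (ChernLu.metricMatrix g ψ) (ChernLu.localRep e ψ f) α β (e p)) v w +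
          ChernLu.form11 e p (fun α β =>
            ChernLu.domainCurvTerm (h.matrix e)
              (ChernLu.metricMatrix g ψ) (ChernLu.localRep e ψ f) α β (e p) -
            ChernLu.targetCurvTerm (h.matrix e)
              (ChernLu.metricMatrix g ψ) (ChernLu.localRep e ψ f) α β (e p)) v w) ∧
      ChernLu.laplacian h e (ChernLu.energy h g f) p =
        ChernLu.tr11 (h.matrix e) (ChernLu.gradTerm (h.matrix e)
          (ChernLu.metricMatrix g ψ) (ChernLu.localRep e ψ f)) (e p) +
        ChernLu.tr11 (h.matrix e) (ChernLu.domainCurvTerm (h.matrix e)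
          (ChernLu.metricMatrix g ψ) (ChernLu.localRep e ψ f)) (e p) -
        ChernLu.tr11 (h.matrix e) (ChernLu.targetCurvTerm (h.matrix e)
          (ChernLu.metricMatrix g ψ) (ChernLu.localRep e ψ f)) (e p) := by
  refine ⟨ChernLu.contMDiff_energy h g hf, fun e he ψ hψ p hp hfp => ⟨fun v w => ?_, ?_⟩⟩
  · simp only [ChernLu.ddbar, ChernLu.form11,
      ChernLu.complexHessian_energy h g hf hph he hψ hp hfp, add_mul, Finset.sum_add_distrib]
  · simp only [ChernLu.laplacian, ChernLu.tr11,
      ChernLu.complexHessian_energy h g hf hph he hψ hp hfp, ← Finset.sum_add_distrib,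
      ← Finset.sum_sub_distrib]
    exact Finset.sum_congr rfl fun α _ => Finset.sum_congr rfl fun β _ => by ring
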